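/- Consider the asymmetric external memory model with primary memory of size $\Theta(M)$ and blocks of size $B$ (both measured in records), in which reads and writes of blocks between primary and secondary memory are counted and computation in primary memory is free. Let $k\ge 1$ be an integer, let $B\ge 1$ divide $M$, and let $l=kM/B\ge 8$. A buffer tree with branching factor $l$ is an $(a,b)$-tree with $a=l/4$, $b=l$: all leaves have the same depth, every internal node has between $l/4$ and $l$ children (a root that is internal may have fewer, but at least $2$) whose subtrees are separated by sorted keys, and every leaf holds between $lB/4$ and $lB$ sorted records in at most $l$ blocks (a root that is a leaf may hold fewer records). Moreover every node has a buffer, a dense list of blocks of records that belong to its subtree. A node is full when its buffer holds at least $lB$ records. The last, partial block of the root's buffer is kept in primary memory. A record is inserted by appending it to the root's buffer. If this makes the root full, then: 1. As long as there is a full internal node, it is emptied: the first $lB$ records of its buffer are sorted by a selection sort with $k$ scans, each of which outputs the next $M$ records, and they are merged with the remaining records of the buffer (which are already sorted) while being appended to the buffers of the children. 2. Then the buffer of every full leaf is sorted in the same way and merged with the records of the leaf; a leaf with more than $lB$ records is split evenly, and so, going up the tree, is every internal node that now has more than $l$ children; new roots are added as needed. Theorem. There is an absolute constant $C$ such that for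 all such $k,M,B$, every $n\ge 0$ and every sequence of $n$ insertions of distinct keys into the initially empty tree, the result is a buffer tree with branching factor $l$ holding exactly the inserted records, none of whose nodes is full, and the insertions together perform at most $$C\,n\,\frac{k}{B}\bigl(1+\log_{kM/B}n\bigr)\ \text{reads}\quad\text{and}\quad C\,n\,\frac{1}{B}\bigl(1+\log_{kM/B}n\bigr)\ \text{writes}$$ (both bounds being $0$ for $n=0$), while never using more than $C\,M$ locations of primary memory; between insertions only the partial last block of the root's buffer occupies primary memory (references and $O(1)$ bookkeeping words not counted). That is, each insertion costs amortized $O((k/B)(1+\log_{kM/B}n))$ reads and $O((1/B)(1+\log_{kM/B}n))$ writes. -/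

import Mathlib

universe u

namespace AEM

/-! ### The asymmetric external memory model

Programs are written in a state monad that meters block transfers and the occupancy of primary
memory. Data in secondary memory lives in cells `Stored α`; the only operations of a program that
look inside a cell or make a new one are `load` (one read) and `store` (one write). A program may
hold, copy and relink references to cells. Computation in primary memory is free. -/

/-- The meter: numbers of block reads and block writes so far, the number of locations of primary
memory occupied now, and the maximum of that number so far. -/
structure Meter where
  reads : ℕ
  writes : ℕ
  held : ℤ
  peak : ℤ

/-- The meter at the start of a computation, with empty primary memory. -/
def Meter.zero : Meter := ⟨0, 0, 0, 0⟩

/-- Programs of the model with result in `α`. -/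
def Prog (α : Type u) : Type u := Meter → α × Meter

instance : Monad Prog.{u} where
  pure a := fun m => (a, m)
  bind p f := fun m => f (p m).1 (p m).2

/-- A cell (one block) of secondary memory. -/
structure Stored (α : Type u) : Type u where
  contents : α

/-- Number of locations that a value of `α` takes up in primary memory. -/
class Footprint (α : Type u) where
  words : α → ℕ

/-- A list of records takes one location for each record. -/
instance (K : Type u) : Footprint (List K) := ⟨List.length⟩

/-- `n` locations of primary memory are taken into use. -/
def occupy (n : ℕ) : Prog PUnit.{u+1} := fun m =>
  (⟨⟩, { m with held := m.held + n, peak := max m.peak (m.held + n) })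

/-- `n` locations of primary memory are given up, at no cost. -/
def release (n : ℕ) : Prog PUnit.{u+1} := fun m => (⟨⟩, { m with held := m.held - n })

/-- The read instruction: the contents of a cell are copied to primary memory. -/
def load {α : Type u} [Footprint α] (c : Stored α) : Prog α := fun m =>
  (c.contents,
    { reads := m.reads + 1
      writes := m.writes
      held := m.held + Footprint.words c.contents
      peak := max m.peak (m.held + Footprint.words c.contents) })

/-- The write instruction: a value leaves primary memory for a cell of secondary memory. -/
def store {α : Type u} [Footprint α] (a : α) : Prog (Stored α) := fun m =>
  (⟨a⟩,
    { reads := m.reads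
      writes := m.writes + 1
      held := m.held - Footprint.words a
      peak := m.peak })

/-- Move one location of bookkeeping to a work list in secondary memory. -/
def save : Prog PUnit.{u+1} := fun m =>
  (⟨⟩, { m with writes := m.writes + 1, held := m.held - 1 })

/-- Fetch one location of bookkeeping back from a work list in secondary memory. -/
def restore : Prog PUnit.{u+1} := fun m =>
  (⟨⟩, { m with reads := m.reads + 1, held := m.held + 1, peak := max m.peak (m.held + 1) })

/-- Run a program on every entry of a list, from left to right. -/
def forEach {α β : Type u} (f : α → Prog β) : List α → Prog (List β)
  | [] => pure []
  | a :: as => do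
      let b ← f a
      let bs ← forEach f as
      pure (b :: bs)

/-- The parameters: primary memory size `M` and block size `B`, both counted in records, and the
extra branching factor `k`. -/
structure Params where
  k : ℕ
  M : ℕ
  B : ℕ

/-- The branching factor `l = kM/B`. -/
def Params.l (P : Params) : ℕ := P.k * P.M / P.B

section Files

variable {K : Type u} [LinearOrder K]

/-- A block of records. A sequence of records is kept as a list of blocks. -/
abbrev Block (K : Type u) : Type u := Stored (List K)

/-- The records in a list of blocks. -/
def contentsOf (bs : List (Block K)) : List K := (bs.map Stored.contents).flatten

/-- `ys` in increasing order, cut off after the `m` smallest records. -/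
def smallest (m : ℕ) (ys : List K) : List K := (ys.insertionSort (· ≤ ·)).take m

/-- One phase of selection sort: a scan that retains in primary memory the `M` smallest records
seen so far among those above `last` (the largest record output in earlier phases, if any). -/
def scan (P : Params) (last : WithBot K) : List (Block K) → List K → Prog (List K)
  | [], acc => pure acc
  | b :: bs, acc => do
      let xs ← load b
      let acc' := smallest P.M (acc ++ xs.filter (fun x : K => last < (x : WithBot K)))
      release (acc.length + xs.length - acc'.length)
      scan P last bs acc'

/-- Write records held in primary memory to at most `n` new blocks of size `B`. -/
def writeOut (P : Params) : ℕ → List K → Prog (List (Block K))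
  | 0, _ => pure []
  | n + 1, ys =>
      if ys = [] then pure []
      else do
        let b ← store (ys.take P.B)
        let bs ← writeOut P n (ys.drop P.B)
        pure (b :: bs)

/-- Selection sort in the given number of phases, each of which outputs the next `M` records. -/
def selectionSort (P : Params) : ℕ → WithBot K → List (Block K) → Prog (List (Block K))
  | 0, _, _ => pure []
  | r + 1, last, bs => do
      let ys ← scan P last bs []
      let out ← writeOut P (P.M / P.B) ys
      let rest ← selectionSort P r (ys.getLast? : Option K) bs
      pure (out ++ rest)

/-- A sequential reader: the unread rest of the block in primary memory, and the blocks to come. -/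
structure Reader (K : Type u) : Type u where
  cur : List K
  rest : List (Block K)

/-- Start reading a list of blocks. -/
def Reader.start (bs : List (Block K)) : Reader K := ⟨[], bs⟩

/-- Load the next block if the current one is used up. -/
def Reader.refill (s : Reader K) : Prog (Reader K) :=
  match s.cur, s.rest with
  | [], b :: bs => do
      let xs ← load b
      pure ⟨xs, bs⟩
  | _, _ => pure s

/-- Two readers that are being merged. -/
abbrev Pair (K : Type u) : Type u := Reader K × Reader K

/-- Take the smaller of the two next records, provided that it is at most `u`. -/
def pull (u : WithTop K) (p : Pair K) : Prog (Option K × Pair K) := do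
  let s ← p.1.refill
  let t ← p.2.refill
  match s.cur, t.cur with
  | [], [] => pure (none, (s, t))
  | x :: xs, [] =>
      if (x : WithTop K) ≤ u then pure (some x, (⟨xs, s.rest⟩, t)) else pure (none, (s, t))
  | [], y :: ys =>
      if (y : WithTop K) ≤ u then pure (some y, (s, ⟨ys, t.rest⟩)) else pure (none, (s, t))
  | x :: xs, y :: ys =>
      if x ≤ y then
        if (x : WithTop K) ≤ u then pure (some x, (⟨xs, s.rest⟩, t)) else pure (none, (s, t))
      else
        if (y : WithTop K) ≤ u then pure (some y, (s, ⟨ys, t.rest⟩)) else pure (none, (s, t))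

/-- Take records that are at most `u` from the merge, as long as there are any but at most `n`. -/
def pullMany (u : WithTop K) : ℕ → Pair K → Prog (List K × Pair K)
  | 0, p => pure ([], p)
  | n + 1, p => do
      let r ← pull u p
      match r.1 with
      | none => pure ([], r.2)
      | some x => do
          let q ← pullMany u n r.2
          pure (x :: q.1, q.2)

/-- Write all records of the merge that are at most `u` to new blocks. The number is a bound on the
iterations of the loop. The program also returns how many records it wrote. -/
def emit (P : Params) (u : WithTop K) : ℕ → Pair K → Prog (List (Block K) × ℕ × Pair K)
  | 0, p => pure ([], 0, p)
  | n + 1, p => do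
      let q ← pullMany u P.B p
      if q.1 = [] then pure ([], 0, q.2)
      else do
        let b ← store q.1
        let r ← emit P u n q.2
        pure (b :: r.1, q.1.length + r.2.1, r.2.2)

/-- Merge two sorted sequences, of `n` records or fewer together, to a new sequence of blocks. -/
def mergeFiles (P : Params) (n : ℕ) (as bs : List (Block K)) : Prog (List (Block K)) := do
  let r ← emit P ⊤ n (Reader.start as, Reader.start bs)
  pure r.1

end Files

/-! ### The buffer tree -/

/-- The header of a node: the largest key that belongs to its subtree (`⊤` if there is no bound),
the list of blocks of its buffer and the number `size` of records in the buffer, the mark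
`emptied`, which an internal node carries while it has been emptied in the current
buffer-emptying process but has not been rebalanced yet, and the node's `body`. The keys of an
internal node are the bounds `upper` of its children other than the last. -/
structure Node (K σ : Type u) : Type u where
  upper : WithTop K
  buf : List (Block K)
  size : ℕ
  emptied : Bool
  body : σ

/-- A header is a bounded number of words and is counted as one location. -/
instance (K σ : Type u) : Footprint (Node K σ) := ⟨fun _ => 1⟩

/-- The body of a leaf (height `0`) is the list of blocks with its records; the body of an internal
node is the list of its children, whose height is one less. -/
@[reducible]
def Body (K : Type u) : ℕ → Type u
  | 0 => List (Block K)
  | h + 1 => List (Stored (Node K (Body K h)))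

/-- Nodes of height `h`: all leaves below such a node are at depth `h`. -/
abbrev Tree (K : Type u) (h : ℕ) : Type u := Node K (Body K h)

section Insertion

variable {K : Type u} [LinearOrder K]

/-- Append to the buffer of `v` the records of the merge that belong to `v`: first fill up the last
block of the buffer if it is partial, then append new blocks. -/
def appendTo (P : Params) {σ : Type u} (n : ℕ) (v : Node K σ) (p : Pair K) :
    Prog (Node K σ × Pair K) :=
  match v.buf.getLast?, v.size % P.B with
  | some c, _ + 1 => do
      let ys ← load c
      let q ← pullMany v.upper (P.B - ys.length) p
      let b ← store (ys ++ q.1)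
      let r ← emit P v.upper n q.2
      pure ({ v with buf := v.buf.dropLast ++ (b :: r.1), size := v.size + (q.1.length + r.2.1) },
        r.2.2)
  | _, _ => do
      let r ← emit P v.upper n p
      pure ({ v with buf := v.buf ++ r.1, size := v.size + r.2.1 }, r.2.2)

/-- Distribute a merge of two sorted sequences, of `n` records or fewer together, to the buffers of
a list of children. -/
def distribute (P : Params) {σ : Type u} (n : ℕ) :
    List (Stored (Node K σ)) → Pair K → Prog (List (Stored (Node K σ)))
  | [], _ => pure []
  | c :: cs, p => do
      let v ← load c
      let r ← appendTo P n v p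
      let c' ← store r.1
      let cs' ← distribute P n cs r.2
      pure (c' :: cs')

/-- First phase, below and at a given node. A full internal node is emptied: the first `lB` records
of its buffer are sorted, and are merged with the others (which are sorted already) while they are
distributed to the children. Then the children are treated, while the header waits in a work
list. -/
def emptyDown (P : Params) : (h : ℕ) → Stored (Tree K h) → Prog (Stored (Tree K h))
  | 0, c => pure c
  | h + 1, c => do
      let v ← load c
      if v.size < P.l * P.B then do
        release 1
        pure c
      else do
        let s ← selectionSort P P.k ⊥ (v.buf.take P.l)
        let cs ← distribute P v.size v.body (Reader.start s, Reader.start (v.buf.drop P.l))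
        save
        let cs' ← forEach (emptyDown P h) cs
        restore
        store { v with buf := [], size := 0, emptied := true, body := cs' }

/-- Cut a list into `t` consecutive parts whose lengths differ by at most one. -/
def parts {α : Type u} : ℕ → List α → List (List α)
  | 0, _ => []
  | t + 1, xs => xs.take (xs.length / (t + 1)) :: parts t (xs.drop (xs.length / (t + 1)))

/-- Copy a list of cells. The program also returns the key of the last entry. -/
def copy {α : Type u} [Footprint α] (key : α → WithTop K) :
    WithTop K → List (Stored α) → Prog (WithTop K × List (Stored α))
  | u, [] => pure (u, [])
  | _, c :: cs => do
      let a ← load c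
      let c' ← store a
      let r ← copy key (key a) cs
      pure (r.1, c' :: r.2)

/-- Make one node with an empty buffer from each part; the last node is bounded by `u`. -/
def makeNodes {α : Type u} [Footprint α] (key : α → WithTop K) (u : WithTop K) :
    List (List (Stored α)) → Prog (List (Stored (Node K (List (Stored α)))))
  | [] => pure []
  | [g] => do
      let r ← copy key ⊤ g
      occupy 1
      let c ← store (Node.mk u [] 0 false r.2)
      pure [c]
  | g :: gs => do
      let r ← copy key ⊤ g
      occupy 1
      let c ← store (Node.mk r.1 [] 0 false r.2)
      let cs ← makeNodes key u gs
      pure (c :: cs)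

/-- Split a node with the given entries into `⌈number of entries / l⌉` nodes (one node if it has no
more than `l` entries), with as equal shares as possible. -/
def split {α : Type u} [Footprint α] (P : Params) (key : α → WithTop K) (u : WithTop K)
    (items : List (Stored α)) : Prog (List (Stored (Node K (List (Stored α))))) :=
  makeNodes key u (parts ((items.length + P.l - 1) / P.l) items)

/-- The largest record of a sorted block. -/
def lastKey (xs : List K) : WithTop K := (xs.getLast? : Option K)

/-- Second phase, below and at a given node, which is replaced by one or more nodes. The buffer of a
full leaf is sorted and merged with the records of the leaf, and the leaf is split if it has become
too large; so is an internal node after the second phase for its children. Only internal nodes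
emptied in the first phase can have full leaves below. -/
def rebalance (P : Params) : (h : ℕ) → Stored (Tree K h) → Prog (List (Stored (Tree K h)))
  | 0, c => do
      let v ← load c
      if v.size < P.l * P.B then do
        release 1
        pure [c]
      else do
        let a ← selectionSort P P.k ⊥ (v.buf.take P.l)
        let s ← mergeFiles P v.size a (v.buf.drop P.l)
        let d ← mergeFiles P (v.size + P.l * P.B) s v.body
        release 1
        split P lastKey v.upper d
  | h + 1, c => do
      let v ← load c
      if v.emptied then do
        save
        let css ← forEach (rebalance P h) v.body
        restore
        release 1
        split P Node.upper v.upper css.flatten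
      else do
        release 1
        pure [c]

/-- A buffer tree: the partial last block of the root's buffer, which is kept in primary memory,
and the root in secondary memory. The field `buf` of the root holds the full blocks. -/
structure BufferTree (K : Type u) : Type u where
  tail : List K
  height : ℕ
  root : Stored (Tree K height)

/-- The empty buffer tree: a single leaf. -/
def BufferTree.empty (K : Type u) : BufferTree K := ⟨[], 0, ⟨⟨⊤, [], 0, false, []⟩⟩⟩

/-- Put new roots on top of a list of nodes until there is only one node left. The first number
is a bound on the iterations of the loop. -/
def grow (P : Params) : ℕ → (h : ℕ) → List (Stored (Tree K h)) → Prog (BufferTree K)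
  | _, h, [r] => pure ⟨[], h, r⟩
  | n + 1, h, rs => do
      let rs' ← split P Node.upper ⊤ rs
      grow P n (h + 1) rs'
  | 0, _, _ => pure (BufferTree.empty K)

/-- Insertion of a record `x`, which arrives in primary memory. -/
def insert (P : Params) (x : K) (T : BufferTree K) : Prog (BufferTree K) := do
  occupy 1
  let ys := T.tail ++ [x]
  if ys.length < P.B then pure { T with tail := ys }
  else do
    let b ← store ys
    let v ← load T.root
    let r ← store { v with buf := v.buf ++ [b], size := v.size + P.B }
    if v.size + P.B < P.l * P.B then pure ⟨[], T.height, r⟩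
    else do
      let r' ← emptyDown P T.height r
      let rs ← rebalance P T.height r'
      grow P rs.length T.height rs

/-- Insertion of the records of a list, one after the other. -/
def insertAll (P : Params) : List K → BufferTree K → Prog (BufferTree K)
  | [], T => pure T
  | x :: xs, T => do
      let T' ← insert P x T
      insertAll P xs T'

end Insertion

/-! ### The invariants of a buffer tree between insertions -/

section Invariants

variable {K : Type u} [LinearOrder K]

/-- All records in a subtree, in buffers and in leaves. -/
def recordsOf : (h : ℕ) → Tree K h → List K
  | 0, v => contentsOf v.buf ++ contentsOf v.body
  | h + 1, v => contentsOf v.buf ++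
      (List.map (fun c : Stored (Tree K h) => recordsOf h c.contents) v.body).flatten

/-- All records in a buffer tree. -/
def BufferTree.records (T : BufferTree K) : List K :=
  T.tail ++ recordsOf T.height T.root.contents

/-- A dense list of blocks: no block is empty, and all blocks but possibly the last are full. -/
def Dense (B : ℕ) (bs : List (Block K)) : Prop :=
  (∀ b ∈ bs, 0 < b.contents.length ∧ b.contents.length ≤ B) ∧
    ∀ b ∈ bs.dropLast, b.contents.length = B

/-- A node of height `h` is as it has to be in a buffer tree with branching factor `l`: its buffer
is dense and not full and its keys respect its bound; a leaf holds between `lB/4` and `lB` sorted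
records in at most `l` blocks; an internal node has between `l/4` and `l` children, whose subtrees
are separated by the keys. A root may hold fewer records, or have two or more children. -/
def NodeOK (l B : ℕ) : (h : ℕ) → (isRoot : Bool) → Tree K h → Prop
  | 0, isRoot, v =>
      Dense B v.buf ∧ v.size = (contentsOf v.buf).length ∧ v.size < l * B ∧
      (∀ x ∈ recordsOf 0 v, (x : WithTop K) ≤ v.upper) ∧
      Dense B v.body ∧ (contentsOf v.body).Pairwise (· < ·) ∧
      List.length v.body ≤ l ∧ (contentsOf v.body).length ≤ l * B ∧
      (isRoot = false → l * B ≤ 4 * (contentsOf v.body).length)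
  | h + 1, isRoot, v =>
      Dense B v.buf ∧ v.size = (contentsOf v.buf).length ∧ v.size < l * B ∧
      (∀ x ∈ recordsOf (h + 1) v, (x : WithTop K) ≤ v.upper) ∧
      v.emptied = false ∧
      List.length v.body ≤ l ∧ 2 ≤ List.length v.body ∧
      (isRoot = false → l ≤ 4 * List.length v.body) ∧
      (∀ c ∈ (v.body : List (Stored (Tree K h))), NodeOK l B h false c.contents) ∧
      List.Pairwise (fun c d : Stored (Tree K h) =>
        c.contents.upper < d.contents.upper ∧
          ∀ x ∈ recordsOf h d.contents, c.contents.upper < (x : WithTop K)) v.body ∧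
      (∀ c ∈ List.getLast? (v.body : List (Stored (Tree K h))), c.contents.upper = v.upper)

/-- `T` is a buffer tree with branching factor `l` and block size `B`. The buffer of the root is
dense: only its last block, the one in primary memory, is partial. -/
def IsBufferTree (l B : ℕ) (T : BufferTree K) : Prop :=
  NodeOK l B T.height true T.root.contents ∧ T.root.contents.upper = ⊤ ∧
    (∀ b ∈ T.root.contents.buf, b.contents.length = B) ∧ T.tail.length < B

end Invariants

end AEM

/-! The cost bound is a potential argument. One number `w` controls reads and writes together: each
routine that may sort makes at most `k * w` reads and `w` writes. Only selection sort needs the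
factor `k` (`k * l` reads against `l` writes for the `lB = kM` records it sorts). All other
transfers, reads and writes alike, are simply counted in `w`, which suffices since `k ≥ 1`.

The potential `credit` gives `wt i` units to each record waiting in a buffer at height `i`, and
`3lB` units to each internal node marked as emptied. A transfer costs `B` units. Both phases, at a
node and below it, satisfy `B * w + credit after ≤ credit before + B`, with an extra term in the
second phase. The spare `B` pays for looking at the node, and is charged to its parent. - Emptying a
node (`runs_emptyDown`) moves at least `lB` records down one level at a cost linear in their number,
including the mark; this needs 13 units per record. - Rebalancing an emptied node (`runs_rebalance`)
is paid by the mark, except for the part due to new children. - Emptying a leaf buffer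
(`runs_rebalance_leaf`) costs 11 units per record. Splitting into `t` leaves is possible only if the
buffer has at least `4B(t - 1)` records, so one more unit per record gives each new leaf `4B` units.
With `H + 1` such units every new node can pay `4B` at each level above it and at the growth of the
root (`runs_grow`).

Hence the weight `13h + 12 + H` at height `h`, and `14H + 16` units for each insertion, where `H`
bounds the final height. Minimum degrees give `l ^ h ≤ 4 ^ h * n`, and `l ≥ 8` makes the height at
most `3 log_l n`.

Correctness rests on one observation: a child that is not full has fewer than `lB` records, so when
it receives a sorted batch, everything in its buffer beyond the first `lB` records is sorted.
Sorting a prefix of length `lB` and merging is therefore enough, whatever the size of the buffer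
(`Distributed.spec`, `runs_sortBuffer`). Primary memory stays at `M + 6B` at every depth of the
recursion because the header is put aside before the children are treated. -/

namespace AEM

/-! ### Cost triples for programs -/

section Runs

variable {α β : Type u}

/-- From every meter, `p` returns `a` with at most `r` reads and `w` writes, changes the occupancy
by `d`, and never exceeds the initial occupancy by more than `pk`. -/
def Runs (p : Prog α) (a : α) (r w : ℕ) (d pk : ℤ) : Prop :=
  ∀ m : Meter, (p m).1 = a ∧ (p m).2.reads ≤ m.reads + r ∧ (p m).2.writes ≤ m.writes + w ∧
    (p m).2.held = m.held + d ∧ (p m).2.peak ≤ max m.peak (m.held + pk)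

theorem Runs.pure (a : α) : Runs (pure a) a 0 0 0 0 :=
  fun _ => ⟨rfl, le_rfl, le_rfl, (add_zero _).symm, le_max_left _ _⟩

theorem Runs.mono {p : Prog α} {a : α} {r w r' w' : ℕ} {d d' pk pk' : ℤ} (h : Runs p a r w d pk)
    (hr : r ≤ r') (hw : w ≤ w') (hd : d = d') (hp : pk ≤ pk') : Runs p a r' w' d' pk' := by
  intro m
  obtain ⟨h1, h2, h3, h4, h5⟩ := h m
  exact ⟨h1, by omega, by omega, by omega, by omega⟩

/-- Sequencing adds costs; the second peak is measured from the occupancy that the first program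
leaves. All later cost proofs chain this rule and close with linear arithmetic. -/
theorem Runs.bind {p : Prog α} {f : α → Prog β} {a : α} {b : β} {r1 w1 r2 w2 : ℕ}
    {d1 pk1 d2 pk2 : ℤ} (h1 : Runs p a r1 w1 d1 pk1) (h2 : Runs (f a) b r2 w2 d2 pk2) :
    Runs (p >>= f) b (r1 + r2) (w1 + w2) (d1 + d2) (max pk1 (d1 + pk2)) := by
  intro m
  obtain ⟨h11, h12, h13, h14, h15⟩ := h1 m
  have e : (p >>= f) m = f (p m).1 (p m).2 := rfl
  rw [e, h11]
  obtain ⟨h21, h22, h23, h24, h25⟩ := h2 (p m).2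
  exact ⟨h21, by omega, by omega, by omega, by omega⟩

theorem runs_occupy (n : ℕ) : Runs (occupy.{u} n) ⟨⟩ 0 0 n n :=
  fun _ => ⟨rfl, le_rfl, le_rfl, rfl, le_rfl⟩

theorem runs_release (n : ℕ) : Runs (release.{u} n) ⟨⟩ 0 0 (-n) 0 :=
  fun _ => ⟨rfl, le_rfl, le_rfl, by simp [release, sub_eq_add_neg], le_max_left _ _⟩

theorem runs_load [Footprint α] (c : Stored α) :
    Runs (load c) c.contents 1 0 (Footprint.words c.contents) (Footprint.words c.contents) :=
  fun _ => ⟨rfl, le_rfl, le_rfl, rfl, le_rfl⟩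

theorem runs_store [Footprint α] (a : α) :
    Runs (store a) ⟨a⟩ 0 1 (-(Footprint.words a)) 0 :=
  fun _ => ⟨rfl, le_rfl, le_rfl, by simp [store, sub_eq_add_neg], le_max_left _ _⟩

theorem runs_loadList {K : Type u} (b : Block K) :
    Runs (load b) b.contents 1 0 b.contents.length b.contents.length := runs_load b

theorem runs_storeList {K : Type u} (a : List K) :
    Runs (store a) ⟨a⟩ 0 1 (-(a.length : ℤ)) 0 := runs_store a

theorem runs_loadNode {K σ : Type u} (c : Stored (Node K σ)) :
    Runs (load c) c.contents 1 0 1 1 := runs_load c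

theorem runs_storeNode {K σ : Type u} (a : Node K σ) :
    Runs (store a) ⟨a⟩ 0 1 (-1) 0 := runs_store a

theorem runs_save : Runs save.{u} ⟨⟩ 0 1 (-1) 0 :=
  fun _ => ⟨rfl, le_rfl, le_rfl, by simp [save, sub_eq_add_neg], le_max_left _ _⟩

theorem runs_restore : Runs restore.{u} ⟨⟩ 1 0 1 1 :=
  fun _ => ⟨rfl, le_rfl, le_rfl, rfl, le_rfl⟩

/-- A loop over programs that leave the occupancy unchanged. -/
theorem runs_forEach {f : α → Prog β} {g : α → β} {w : α → ℕ} {k : ℕ} {pk : ℤ} (hpk : 0 ≤ pk)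
    (as : List α) (h : ∀ a ∈ as, Runs (f a) (g a) (k * w a) (w a) 0 pk) :
    Runs (forEach f as) (as.map g) (k * (as.map w).sum) (as.map w).sum 0 pk := by
  induction as with
  | nil => exact (Runs.pure _).mono (by omega) (by omega) rfl hpk
  | cons a as ih =>
    refine Runs.mono (Runs.bind (h a (by simp)) (Runs.bind (ih fun b hb => h b (by simp [hb]))
      (Runs.pure _))) ?_ ?_ ?_ ?_
    all_goals try simp only [List.map_cons, List.sum_cons, mul_add]
    all_goals omega

end Runs

/-! ### Selecting the smallest records in one scan -/

section Sorting

variable {K : Type u} [LinearOrder K]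

/-- Insertion only pushes entries to the right, so what lies beyond position `m` never enters the
first `m` places. -/
theorem take_orderedInsert (x : K) (m : ℕ) (L : List K) :
    (L.orderedInsert (· ≤ ·) x).take m = ((L.take m).orderedInsert (· ≤ ·) x).take m := by
  induction L generalizing m with
  | nil => simp
  | cons y L ih =>
    cases m with
    | zero => simp
    | succ m =>
      simp only [List.orderedInsert_cons, List.take_succ_cons]
      split_ifs with h
      · cases m <;> simp [List.take_take]
      · simp [ih m]

theorem take_foldr_orderedInsert (m : ℕ) (b L : List K) :
    (b.foldr (List.orderedInsert (· ≤ ·)) L).take m =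
      (b.foldr (List.orderedInsert (· ≤ ·)) (L.take m)).take m := by
  induction b with
  | nil => simp
  | cons x b ih =>
    simp only [List.foldr_cons]
    rw [take_orderedInsert, ih, ← take_orderedInsert]

theorem insertionSort_append (a b : List K) : (b ++ a).insertionSort (· ≤ ·) =
    b.foldr (List.orderedInsert (· ≤ ·)) (a.insertionSort (· ≤ ·)) := by
  simp [List.insertionSort, List.foldr_append]

theorem insertionSort_congr {a b : List K} (h : a.Perm b) :
    a.insertionSort (· ≤ ·) = b.insertionSort (· ≤ ·) :=
  (((List.perm_insertionSort _ a).trans h).trans (List.perm_insertionSort _ b).symm).eq_of_pairwise'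
    (List.pairwise_insertionSort _ _) (List.pairwise_insertionSort _ _)

theorem insertionSort_smallest (m : ℕ) (a : List K) :
    (smallest m a).insertionSort (· ≤ ·) = smallest m a :=
  List.Pairwise.insertionSort_eq ((List.pairwise_insertionSort _ _).take)

/-- Discarding all but the `m` smallest records early does no harm: this keeps the state of a scan
equal to the `m` smallest records seen. -/
theorem smallest_smallest_append (m : ℕ) (a b : List K) :
    smallest m (smallest m a ++ b) = smallest m (a ++ b) := by
  have e (c : List K) : smallest m (c ++ b) = smallest m (b ++ c) := by
    rw [smallest, smallest, insertionSort_congr List.perm_append_comm]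
  rw [e, e, smallest, insertionSort_append, insertionSort_smallest, smallest,
    ← take_foldr_orderedInsert, ← insertionSort_append, smallest]

theorem length_smallest (m : ℕ) (a : List K) : (smallest m a).length = min m a.length := by
  simp [smallest]

theorem runs_scan (P : Params) (last : WithBot K) (bs : List (Block K)) (zs : List K)
    (hB : ∀ b ∈ bs, b.contents.length ≤ P.B) :
    Runs (scan P last bs (smallest P.M zs))
      (smallest P.M (zs ++ (contentsOf bs).filter fun x : K => last < (x : WithBot K)))
      bs.length 0
      ((smallest P.M (zs ++ (contentsOf bs).filter fun x : K => last < (x : WithBot K))).length -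
        (smallest P.M zs).length) (P.M + P.B - (smallest P.M zs).length) := by
  induction bs generalizing zs with
  | nil => 
    simp only [scan, contentsOf, List.map_nil, List.flatten_nil, List.filter_nil, List.append_nil]
    have := length_smallest P.M zs
    exact (Runs.pure _).mono le_rfl le_rfl (by omega) (by omega)
  | cons b bs ih =>
    have hb := hB b (by simp)
    have h1 : smallest P.M (smallest P.M zs ++
        b.contents.filter (fun x : K => last < (x : WithBot K))) =
        smallest P.M (zs ++ b.contents.filter (fun x : K => last < (x : WithBot K))) :=
      smallest_smallest_append _ _ _
    have h2 := ih (zs ++ b.contents.filter (fun x : K => last < (x : WithBot K)))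
      fun c hc => hB c (by simp [hc])
    have h3 : zs ++ b.contents.filter (fun x : K => last < (x : WithBot K)) ++
        (contentsOf bs).filter (fun x : K => last < (x : WithBot K)) =
        zs ++ (contentsOf (b :: bs)).filter (fun x : K => last < (x : WithBot K)) := by
      simp [contentsOf]
    rw [h3, ← h1] at h2
    have h4 := List.length_filter_le (fun x : K => last < (x : WithBot K)) b.contents
    have h5 := length_smallest P.M (smallest P.M zs ++
        b.contents.filter (fun x : K => last < (x : WithBot K)))
    have h6 := length_smallest P.M zs
    rw [List.length_append] at h5
    refine Runs.mono (Runs.bind (runs_loadList b) (Runs.bind (runs_release _) h2)) ?_ ?_ ?_ ?_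
    all_goals try simp only [List.length_cons]
    all_goals omega

end Sorting
-- Selection sort on blocks
section Sorting

variable {K : Type u}

@[simp] theorem contentsOf_nil : contentsOf ([] : List (Block K)) = [] := rfl

@[simp] theorem contentsOf_cons (b : Block K) (bs : List (Block K)) :
    contentsOf (b :: bs) = b.contents ++ contentsOf bs := rfl

@[simp] theorem contentsOf_append (as bs : List (Block K)) :
    contentsOf (as ++ bs) = contentsOf as ++ contentsOf bs := by
  simp [contentsOf]

theorem length_contentsOf {B : ℕ} {bs : List (Block K)} (h : ∀ b ∈ bs, b.contents.length = B) :
    (contentsOf bs).length = bs.length * B := by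
  induction bs with
  | nil => simp
  | cons b bs ih =>
    have := ih fun c hc => h c (by simp [hc])
    simp [this, h b (by simp)]
    ring

theorem runs_writeOut (P : Params) (hB : 0 < P.B) (n : ℕ) (ys : List K)
    (h : ys.length = n * P.B) :
    ∃ out, Runs (writeOut P n ys) out 0 n (-(ys.length : ℤ)) 0 ∧
      (∀ b ∈ out, b.contents.length = P.B) ∧ contentsOf out = ys := by
  induction n generalizing ys with
  | zero =>
    obtain rfl : ys = [] := List.length_eq_zero_iff.1 (by simpa using h)
    exact ⟨[], (Runs.pure _).mono le_rfl le_rfl (by simp) le_rfl, by simp, by simp⟩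
  | succ n ih =>
    rw [Nat.succ_mul] at h
    obtain ⟨out, h1, h2, h3⟩ := ih (ys.drop P.B) (by simp; omega)
    refine ⟨⟨ys.take P.B⟩ :: out, ?_, ?_, ?_⟩
    · have hne : ys ≠ [] := by rintro rfl; simp at h; omega
      simp only [writeOut, if_neg hne]
      refine Runs.mono (Runs.bind (runs_storeList _) (Runs.bind h1 (Runs.pure _))) ?_ ?_ ?_ ?_
      all_goals try simp only [List.length_take, List.length_drop]
      all_goals omega
    · intro b hb
      rcases List.mem_cons.1 hb with rfl | hb
      · simp; omega
      · exact h2 b hb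
    · simp [h3]

variable [LinearOrder K]

theorem insertionSort_filter (p : K → Bool) (X : List K) :
    (X.filter p).insertionSort (· ≤ ·) = (X.insertionSort (· ≤ ·)).filter p := by
  rw [insertionSort_congr ((List.perm_insertionSort (· ≤ ·) X).symm.filter p)]
  exact List.Pairwise.insertionSort_eq ((List.pairwise_insertionSort _ _).filter p)

theorem pairwise_lt_insertionSort {X : List K} (h : X.Nodup) :
    (X.insertionSort (· ≤ ·)).Pairwise (· < ·) := by
  have h1 := List.pairwise_insertionSort (· ≤ ·) X
  have h2 : (X.insertionSort (· ≤ ·)).Nodup := (List.perm_insertionSort _ X).nodup_iff.2 h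
  exact (h1.and h2).imp fun h => lt_of_le_of_ne h.1 h.2

/-- The last entry of a list, or `⊥`. -/
def lastBot (xs : List K) : WithBot K := (xs.getLast? : Option K)

/-- In a strictly increasing list the last record output separates what has been output from what
remains. Distinctness of the keys is essential: a duplicate of that record would be lost. -/
theorem filter_gt_getLast {A D : List K} (h : (A ++ D).Pairwise (· < ·)) (hA : A ≠ []) :
    (A ++ D).filter (fun x : K => lastBot A < (x : WithBot K)) = D := by
  obtain ⟨A, y, rfl⟩ : ∃ A' y, A = A' ++ [y] := ⟨_, _, (List.dropLast_append_getLast hA).symm⟩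
  have e : lastBot (A ++ [y]) = (y : WithBot K) := by
    simp [lastBot]; rfl
  rw [e, List.filter_append, List.filter_eq_nil_iff.2, List.filter_eq_self.2, List.nil_append]
  · intro x hx
    have := (List.pairwise_append.1 h).2.2 y (by simp) x hx
    simpa using this
  · intro x hx
    have := (List.pairwise_append.1 (List.pairwise_append.1 h).1).2.2
    rcases List.mem_append.1 hx with hx | hx
    · simpa using (this x hx y (by simp)).le
    · simp at hx; simp [hx]

/-- Each phase removes exactly `M` records from those above `last`, so `r` phases exhaust `r * M` of
them. As `B` divides `M`, all output blocks are full and the outputs of the phases concatenate to a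
dense list. -/
theorem runs_selectionSort (P : Params) (hB : 0 < P.B) (hM : 0 < P.M) (hBM : P.B ∣ P.M)
    (bs : List (Block K)) (hbs : ∀ b ∈ bs, b.contents.length ≤ P.B) (hnd : (contentsOf bs).Nodup)
    (r : ℕ) (last : WithBot K)
    (h : ((contentsOf bs).filter fun x : K => last < (x : WithBot K)).length = r * P.M) :
    ∃ out, Runs (selectionSort P r last bs) out (r * bs.length) (r * (P.M / P.B)) 0 (P.M + P.B) ∧
      (∀ b ∈ out, b.contents.length = P.B) ∧
      contentsOf out = ((contentsOf bs).filter fun x : K =>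
        last < (x : WithBot K)).insertionSort (· ≤ ·) := by
  induction r generalizing last with
  | zero =>
    have e := List.length_eq_zero_iff.1 (h.trans (zero_mul _))
    exact ⟨[], (Runs.pure _).mono (by simp) (by simp) (by simp) (by omega), by simp, by rw [e]; rfl⟩
  | succ r ih =>
    set F := (contentsOf bs).filter fun x : K => last < (x : WithBot K) with hF
    set S := F.insertionSort (· ≤ ·) with hS
    have hlen : S.length = r * P.M + P.M := by rw [hS, List.length_insertionSort, h, Nat.succ_mul]
    have hys : smallest P.M F = S.take P.M := rfl
    have hylen : (smallest P.M F).length = P.M := by rw [hys, List.length_take]; omega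
    have hyne : smallest P.M F ≠ [] := by
      intro e; rw [e] at hylen; simp at hylen; omega
    have hsort : S.Pairwise (· < ·) := pairwise_lt_insertionSort (hnd.filter _)
    have hdrop : (S.filter fun x : K =>
        lastBot (smallest P.M F) < (x : WithBot K)) = S.drop P.M := by
      have := filter_gt_getLast (A := smallest P.M F) (D := S.drop P.M)
        (by rw [hys, List.take_append_drop]; exact hsort) hyne
      rwa [hys, List.take_append_drop] at this
    have hlast : ∃ y ∈ F, lastBot (smallest P.M F) = (y : WithBot K) := by
      refine ⟨(smallest P.M F).getLast hyne, ?_, ?_⟩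
      · have := List.getLast_mem hyne
        exact (List.perm_insertionSort (· ≤ ·) F).mem_iff.1 (List.mem_of_mem_take this)
      · rw [lastBot, List.getLast?_eq_some_getLast hyne]; rfl
    -- The next scan again reads the whole input, but the new threshold lies above `last`, so it
    -- sees only records of `F`.
    have hff : (contentsOf bs).filter (fun x : K =>
        lastBot (smallest P.M F) < (x : WithBot K)) =
        F.filter (fun x : K =>
        lastBot (smallest P.M F) < (x : WithBot K)) := by
      obtain ⟨y, hy, e⟩ := hlast
      rw [e, hF, List.filter_filter]
      refine List.filter_congr fun x _ => ?_
      have hy' : last < (y : WithBot K) := by simpa using (List.mem_filter.1 hy).2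
      by_cases hx : (y : WithBot K) < (x : WithBot K)
      · have := hy'.trans hx
        simp only [hx, this]; rfl
      · simp only [hx, decide_false, Bool.false_and]
    have hfs : ((contentsOf bs).filter (fun x : K =>
        lastBot (smallest P.M F) < (x : WithBot K))).insertionSort
          (· ≤ ·) = S.drop P.M := by
      rw [hff, insertionSort_filter, hdrop]
    obtain ⟨out, h1, h2, h3⟩ := ih (lastBot (smallest P.M F)) (by
      rw [← List.length_insertionSort (· ≤ ·), hfs, List.length_drop]; omega)
    rw [hfs] at h3
    obtain ⟨o, h4, h5, h6⟩ := runs_writeOut P hB (P.M / P.B) (smallest P.M F)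
      (by rw [hylen, Nat.div_mul_cancel hBM])
    have h7 := runs_scan P last bs [] hbs
    rw [List.nil_append, ← hF] at h7
    have h8 : smallest P.M ([] : List K) = [] := by simp [smallest]
    rw [h8] at h7
    refine ⟨o ++ out, ?_, ?_, ?_⟩
    · refine Runs.mono (Runs.bind h7 (Runs.bind h4 (Runs.bind h1 (Runs.pure _)))) ?_ ?_ ?_ ?_
      all_goals try simp only [Nat.succ_mul, List.length_nil]
      all_goals omega
    · intro b hb
      rcases List.mem_append.1 hb with hb | hb
      exacts [h5 b hb, h2 b hb]
    · rw [contentsOf_append, h6, h3, hys, List.take_append_drop]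

end Sorting
-- Dense lists of blocks
section Dense

variable {K : Type u}

theorem dense_nil (B : ℕ) : Dense B ([] : List (Block K)) := by simp [Dense]

theorem dense_cons {B : ℕ} {b : Block K} {bs : List (Block K)} : Dense B (b :: bs) ↔
    (0 < b.contents.length ∧ b.contents.length ≤ B) ∧ (bs = [] ∨ b.contents.length = B) ∧
      Dense B bs := by
  cases bs with
  | nil => simp [Dense]
  | cons c bs => simp [Dense]; tauto

theorem Dense.of_append_left {B : ℕ} {as bs : List (Block K)} (h : Dense B (as ++ bs)) :
    Dense B as := by
  induction as with
  | nil => exact dense_nil B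
  | cons a as ih =>
    rw [List.cons_append, dense_cons] at h
    rw [dense_cons]
    refine ⟨h.1, ?_, ih h.2.2⟩
    rcases h.2.1 with h | h
    · exact Or.inl (List.append_eq_nil_iff.1 h).1
    · exact Or.inr h

theorem Dense.of_append_right {B : ℕ} {as bs : List (Block K)} (h : Dense B (as ++ bs)) :
    Dense B bs := by
  induction as with
  | nil => exact h
  | cons a as ih => exact ih (dense_cons.1 h).2.2

theorem Dense.append {B : ℕ} {as bs : List (Block K)} (ha : ∀ a ∈ as, a.contents.length = B)
    (hB : 0 < B) (hb : Dense B bs) : Dense B (as ++ bs) := by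
  induction as with
  | nil => exact hb
  | cons a as ih =>
    have := ha a (by simp)
    rw [List.cons_append, dense_cons]
    exact ⟨by omega, Or.inr this, ih fun c hc => ha c (by simp [hc])⟩

/-- At most one block is partial. This converts block counts into record counts, at a loss of one
`B`. -/
theorem Dense.length_mul_le {B : ℕ} {bs : List (Block K)} (h : Dense B bs) :
    bs.length * B ≤ (contentsOf bs).length + B := by
  induction bs with
  | nil => simp
  | cons b bs ih =>
    obtain ⟨h1, h2, h3⟩ := dense_cons.1 h
    rw [contentsOf_cons, List.length_append, List.length_cons, Nat.succ_mul]
    rcases h2 with rfl | h2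
    · simp
    · have := ih h3
      omega

theorem Dense.length_mul_lt {B : ℕ} {bs : List (Block K)} (h : Dense B bs) (hne : bs ≠ []) :
    bs.length * B < (contentsOf bs).length + B := by
  induction bs with
  | nil => simp at hne
  | cons b bs ih =>
    obtain ⟨h1, h2, h3⟩ := dense_cons.1 h
    rw [contentsOf_cons, List.length_append, List.length_cons, Nat.succ_mul]
    by_cases hb : bs = []
    · subst hb; simp; omega
    · have := ih h3 hb
      have := h2.resolve_left hb
      omega

theorem Dense.length_le {B : ℕ} {bs : List (Block K)} (h : Dense B bs) :
    (contentsOf bs).length ≤ bs.length * B := by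
  induction bs with
  | nil => simp
  | cons b bs ih =>
    obtain ⟨h1, h2, h3⟩ := dense_cons.1 h
    have := ih h3
    rw [contentsOf_cons, List.length_append, List.length_cons, Nat.succ_mul]
    omega

/-- The first `n` blocks of a dense list with at least `nB` records are full. -/
theorem Dense.take_full {B : ℕ} {bs : List (Block K)} (h : Dense B bs) (hB : 0 < B) {n : ℕ}
    (hn : n * B ≤ (contentsOf bs).length) :
    (bs.take n).length = n ∧ ∀ b ∈ bs.take n, b.contents.length = B := by
  induction n generalizing bs with
  | zero => simp
  | succ n ih =>
    rw [Nat.succ_mul] at hn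
    cases bs with
    | nil => simp at hn; omega
    | cons b bs =>
      obtain ⟨h1, h2, h3⟩ := dense_cons.1 h
      rw [contentsOf_cons, List.length_append] at hn
      obtain ⟨h4, h5⟩ := ih h3 (by omega)
      refine ⟨by simpa using h4, ?_⟩
      intro c hc
      rcases List.mem_cons.1 hc with rfl | hc
      · rcases h2 with rfl | h2
        · simp at hn; omega
        · exact h2
      · exact h5 c hc

end Dense

/-! ### Merging two sorted sequences -/

section Readers

variable {K : Type u}

/-- The records that a reader has yet to deliver. -/
def Reader.toList (s : Reader K) : List K := s.cur ++ contentsOf s.rest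

/-- All blocks of the reader are nonempty and of size at most `B`. -/
def Reader.Ok (B : ℕ) (s : Reader K) : Prop :=
  s.cur.length ≤ B ∧ ∀ b ∈ s.rest, 0 < b.contents.length ∧ b.contents.length ≤ B

theorem Reader.ok_start {B : ℕ} {bs : List (Block K)} (h : Dense B bs) :
    (Reader.start bs).Ok B :=
  ⟨by simp [Reader.start], h.1⟩

/-- Reads are charged to the blocks that disappear from `rest`, so over a whole merge they
telescope. Since no block is empty, an empty `cur` after refilling means the end of the sequence. -/
theorem runs_refill {B : ℕ} (s : Reader K) (h : s.Ok B) :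
    ∃ s', Runs s.refill s' (s.rest.length - s'.rest.length) 0
        ((s'.cur.length : ℤ) - s.cur.length) (B - s.cur.length) ∧ s'.Ok B ∧
      s'.toList = s.toList ∧ s'.rest.length ≤ s.rest.length ∧ (s'.cur = [] → s'.toList = []) := by
  obtain ⟨cur, rest⟩ := s
  have h1 := h.1
  cases cur with
  | cons x xs =>
    exact ⟨_, (Runs.pure _).mono (by simp) le_rfl (by simp) (by dsimp at *; omega), h, rfl, le_rfl,
      by simp⟩
  | nil =>
    cases rest with
    | nil =>
      exact ⟨_, (Runs.pure _).mono (by simp) le_rfl (by simp) (by dsimp at *; omega), h, rfl,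
        le_rfl, by simp [Reader.toList]⟩
    | cons b bs =>
      have hb := h.2 b (by simp)
      refine ⟨⟨b.contents, bs⟩, ?_, ⟨hb.2, fun c hc => h.2 c (by simp [hc])⟩, by simp [Reader.toList],
        by simp, ?_⟩
      · refine Runs.mono (Runs.bind (runs_loadList b) (Runs.pure _)) ?_ ?_ ?_ ?_
        all_goals simp; try omega
      · intro e
        simp only at e
        rw [e] at hb
        simp at hb

namespace Pair

/-- The number of blocks yet to be read. -/
def blocks (p : Pair K) : ℕ := p.1.rest.length + p.2.rest.length

/-- The number of records in primary memory. -/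
def held (p : Pair K) : ℕ := p.1.cur.length + p.2.cur.length

/-- Both readers are in order. -/
def Ok (B : ℕ) (p : Pair K) : Prop := p.1.Ok B ∧ p.2.Ok B

theorem held_le {B : ℕ} {p : Pair K} (h : Ok B p) : held p ≤ 2 * B := by
  have := h.1.1
  have := h.2.1
  simp only [held]
  omega

variable [LinearOrder K]

/-- The outcome of merging what two readers have yet to deliver. -/
def merged (p : Pair K) : List K :=
  List.merge p.1.toList p.2.toList fun a b => decide (a ≤ b)

theorem held_eq_zero {p : Pair K} (h : merged p = []) : held p = 0 := by
  have := congrArg List.length h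
  simp [merged, Reader.toList, List.length_merge] at this
  simp [held, this]

end Pair

variable [LinearOrder K]

/-- Two readers are abstracted to the list `Pair.merged`; one step either detaches its head or
reports that the head exceeds `u` or does not exist. -/
theorem runs_pull {B : ℕ} (u : WithTop K) (p : Pair K) (h : Pair.Ok B p) :
    ∃ (o : Option K) (p' : Pair K),
      Runs (pull u p) (o, p') (Pair.blocks p - Pair.blocks p') 0
        ((Pair.held p' : ℤ) + o.toList.length - Pair.held p) (2 * B - Pair.held p) ∧
      Pair.Ok B p' ∧ Pair.blocks p' ≤ Pair.blocks p ∧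
      ((o = none ∧ Pair.merged p' = Pair.merged p ∧
          (Pair.merged p).takeWhile (fun z : K => decide ((z : WithTop K) ≤ u)) = []) ∨
        ∃ x : K, o = some x ∧ (x : WithTop K) ≤ u ∧ Pair.merged p = x :: Pair.merged p') := by
  obtain ⟨a, b⟩ := p
  obtain ⟨s, hs1, hs2, hs3, hs4, hs5⟩ := runs_refill a h.1
  obtain ⟨t, ht1, ht2, ht3, ht4, ht5⟩ := runs_refill b h.2
  have ha := h.1.1
  have hb := h.2.1
  have hs6 := hs2.1
  have ht6 := ht2.1
  dsimp only at ha hb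
  -- The cost is the same in all branches: after the two refills no block moves and the records in
  -- memory are merely divided between the readers and the result.
  have key : ∀ (o : Option K) (s' t' : Reader K),
      Runs (match s.cur, t.cur with
        | [], [] => pure (none, (s, t))
        | x :: xs, [] =>
            if (x : WithTop K) ≤ u then pure (some x, (⟨xs, s.rest⟩, t)) else pure (none, (s, t))
        | [], y :: ys =>
            if (y : WithTop K) ≤ u then pure (some y, (s, ⟨ys, t.rest⟩)) else pure (none, (s, t))
        | x :: xs, y :: ys =>
            if x ≤ y then
              if (x : WithTop K) ≤ u then pure (some x, (⟨xs, s.rest⟩, t)) else pure (none, (s, t))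
            else
              if (y : WithTop K) ≤ u then pure (some y, (s, ⟨ys, t.rest⟩))
              else pure (none, (s, t)) : Prog (Option K × Pair K)) (o, (s', t')) 0 0 0 0 →
      s'.rest = s.rest → t'.rest = t.rest →
      s'.cur.length + t'.cur.length + o.toList.length = s.cur.length + t.cur.length →
      Runs (pull u (a, b)) (o, (s', t')) (Pair.blocks (a, b) - Pair.blocks (s', t')) 0
        ((Pair.held (s', t') : ℤ) + o.toList.length - Pair.held (a, b))
        (2 * B - Pair.held (a, b)) ∧ Pair.blocks (s', t') ≤ Pair.blocks (a, b) := by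
    intro o s' t' hr e1 e2 e3
    refine ⟨Runs.mono (Runs.bind hs1 (Runs.bind ht1 hr)) ?_ ?_ ?_ ?_, ?_⟩
    all_goals try simp only [Pair.blocks, Pair.held, e1, e2]
    all_goals omega
  have hz : Pair.merged (a, b) = List.merge s.toList t.toList fun a b => decide (a ≤ b) := by
    rw [Pair.merged, hs3, ht3]
  have drop_s : ∀ x xs, s.cur = x :: xs → Reader.Ok B ⟨xs, s.rest⟩ := fun x xs e =>
    ⟨by rw [e, List.length_cons] at hs6; dsimp only; omega, hs2.2⟩
  have drop_t : ∀ x xs, t.cur = x :: xs → Reader.Ok B ⟨xs, t.rest⟩ := fun x xs e =>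
    ⟨by rw [e, List.length_cons] at ht6; dsimp only; omega, ht2.2⟩
  have list_s : ∀ x xs, s.cur = x :: xs → s.toList = x :: Reader.toList ⟨xs, s.rest⟩ :=
    fun x xs e => by rw [Reader.toList, e]; rfl
  have list_t : ∀ x xs, t.cur = x :: xs → t.toList = x :: Reader.toList ⟨xs, t.rest⟩ :=
    fun x xs e => by rw [Reader.toList, e]; rfl
  rw [hz]
  rcases es : s.cur with _ | ⟨x, xs⟩ <;> rcases et : t.cur with _ | ⟨y, ys⟩ <;>
    simp only [es, et] at key
  · obtain ⟨k1, k2⟩ := key none s t (Runs.pure _) rfl rfl (by simp [es, et])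
    refine ⟨none, (s, t), k1, ⟨hs2, ht2⟩, k2, Or.inl ⟨rfl, rfl, ?_⟩⟩
    simp [hs5 es, ht5 et]
  · have e1 := hs5 es
    have e2 := list_t y ys et
    by_cases hy : (y : WithTop K) ≤ u
    · simp only [if_pos hy] at key
      obtain ⟨k1, k2⟩ := key (some y) s ⟨ys, t.rest⟩ (Runs.pure _) rfl rfl (by simp [es])
      refine ⟨some y, (s, ⟨ys, t.rest⟩), k1, ⟨hs2, drop_t y ys et⟩, k2,
        Or.inr ⟨y, rfl, hy, ?_⟩⟩
      simp [Pair.merged, e1, e2]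
    · simp only [if_neg hy] at key
      obtain ⟨k1, k2⟩ := key none s t (Runs.pure _) rfl rfl (by simp [es, et])
      refine ⟨none, (s, t), k1, ⟨hs2, ht2⟩, k2, Or.inl ⟨rfl, rfl, ?_⟩⟩
      simp [e1, e2, hy]
  · have e1 := ht5 et
    have e2 := list_s x xs es
    by_cases hy : (x : WithTop K) ≤ u
    · simp only [if_pos hy] at key
      obtain ⟨k1, k2⟩ := key (some x) ⟨xs, s.rest⟩ t (Runs.pure _) rfl rfl (by simp [et])
      refine ⟨some x, (⟨xs, s.rest⟩, t), k1, ⟨drop_s x xs es, ht2⟩, k2,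
        Or.inr ⟨x, rfl, hy, ?_⟩⟩
      simp [Pair.merged, e1, e2]
    · simp only [if_neg hy] at key
      obtain ⟨k1, k2⟩ := key none s t (Runs.pure _) rfl rfl (by simp [es, et])
      refine ⟨none, (s, t), k1, ⟨hs2, ht2⟩, k2, Or.inl ⟨rfl, rfl, ?_⟩⟩
      simp [e1, e2, hy]
  · have e1 := list_s x xs es
    have e2 := list_t y ys et
    by_cases hxy : x ≤ y
    · simp only [if_pos hxy] at key
      by_cases hy : (x : WithTop K) ≤ u
      · simp only [if_pos hy] at key
        obtain ⟨k1, k2⟩ := key (some x) ⟨xs, s.rest⟩ t (Runs.pure _) rfl rfl (by simp [et]; omega)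
        refine ⟨some x, (⟨xs, s.rest⟩, t), k1, ⟨drop_s x xs es, ht2⟩, k2,
          Or.inr ⟨x, rfl, hy, ?_⟩⟩
        simp [Pair.merged, e1, e2, hxy]
      · simp only [if_neg hy] at key
        obtain ⟨k1, k2⟩ := key none s t (Runs.pure _) rfl rfl (by simp [es, et])
        refine ⟨none, (s, t), k1, ⟨hs2, ht2⟩, k2, Or.inl ⟨rfl, rfl, ?_⟩⟩
        simp [e1, e2, hy, hxy]
    · simp only [if_neg hxy] at key
      by_cases hy : (y : WithTop K) ≤ u
      · simp only [if_pos hy] at key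
        obtain ⟨k1, k2⟩ := key (some y) s ⟨ys, t.rest⟩ (Runs.pure _) rfl rfl (by simp [es]; omega)
        refine ⟨some y, (s, ⟨ys, t.rest⟩), k1, ⟨hs2, drop_t y ys et⟩, k2,
          Or.inr ⟨y, rfl, hy, ?_⟩⟩
        simp [Pair.merged, e1, e2, hxy]
      · simp only [if_neg hy] at key
        obtain ⟨k1, k2⟩ := key none s t (Runs.pure _) rfl rfl (by simp [es, et])
        refine ⟨none, (s, t), k1, ⟨hs2, ht2⟩, k2, Or.inl ⟨rfl, rfl, ?_⟩⟩
        simp [e1, e2, hy, hxy]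

/-- The records at the head of the merge that are at most `u`. -/
def Pair.upTo (u : WithTop K) (p : Pair K) : List K :=
  (merged p).takeWhile fun z : K => decide ((z : WithTop K) ≤ u)

theorem runs_pullMany {B : ℕ} (u : WithTop K) (n : ℕ) (p : Pair K) (h : Pair.Ok B p) :
    ∃ p' : Pair K,
      Runs (pullMany u n p) ((Pair.upTo u p).take n, p') (Pair.blocks p - Pair.blocks p') 0
        ((Pair.held p' : ℤ) + ((Pair.upTo u p).take n).length - Pair.held p)
        (2 * B + n - Pair.held p) ∧
      Pair.Ok B p' ∧ Pair.blocks p' ≤ Pair.blocks p ∧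
      Pair.merged p = (Pair.upTo u p).take n ++ Pair.merged p' := by
  induction n generalizing p with
  | zero =>
    have := Pair.held_le h
    exact ⟨p, (Runs.pure _).mono (by omega) le_rfl (by simp) (by simp; omega), h, le_rfl, by simp⟩
  | succ n ih =>
    have h0 := Pair.held_le h
    obtain ⟨o, q, h1, h2, h3, ⟨rfl, h4, h5⟩ | ⟨x, rfl, h4, h5⟩⟩ := runs_pull u p h
    · have e : (Pair.upTo u p) = [] := h5
      have h6 := Pair.held_le h2
      rw [e]
      refine ⟨q, ?_, h2, h3, by simp [h4]⟩
      refine Runs.mono (Runs.bind h1 (Runs.pure _)) ?_ ?_ ?_ ?_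
      all_goals try simp only [List.take_nil, List.length_nil, Option.toList_none]
      all_goals omega
    · obtain ⟨p', h6, h7, h8, h9⟩ := ih q h2
      have h10 := Pair.held_le h2
      have e : Pair.upTo u p = x :: Pair.upTo u q := by
        rw [Pair.upTo, h5, List.takeWhile_cons, if_pos (by simpa using h4)]; rfl
      rw [e, h5, List.take_succ_cons]
      refine ⟨p', ?_, h7, by omega, by rw [h9]; rfl⟩
      have h11 := List.length_take_le n (Pair.upTo u q)
      have h12 := Pair.held_le h7
      refine Runs.mono (Runs.bind h1 (Runs.bind h6 (Runs.pure _))) ?_ ?_ ?_ ?_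
      all_goals try simp only [List.length_cons, List.length_nil, Option.toList_some]
      all_goals omega

/-- After part of the records bounded by `u` has been pulled, the rest of them is what is bounded by
`u` in the remaining merge, so the output may be cut into blocks. -/
theorem Pair.upTo_of_append {u : WithTop K} {p p' : Pair K} {n : ℕ}
    (h : merged p = (upTo u p).take n ++ merged p') : upTo u p' = (upTo u p).drop n := by
  have h1 : upTo u p ++ (merged p).dropWhile (fun z : K => decide ((z : WithTop K) ≤ u)) = merged p :=
    List.takeWhile_append_dropWhile
  have h2 : upTo u p = (merged p).takeWhile (fun z : K => decide ((z : WithTop K) ≤ u)) := rfl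
  have h3 : ∀ z ∈ (upTo u p).take n, decide ((z : WithTop K) ≤ u) = true := fun z hz => by
    simpa using List.mem_takeWhile_imp (List.mem_of_mem_take hz)
  have h4 : upTo u p = (upTo u p).take n ++ upTo u p' := by
    conv_lhs => rw [h2, h]
    rw [List.takeWhile_append_of_pos h3]; rfl
  have h5 := List.take_append_drop n (upTo u p)
  exact (List.append_cancel_left (h5.trans h4)).symm

/-- Every iteration before the last writes at least one record, so `n` iterations suffice. The `3B`
locations are one block for each reader and one for output. -/
theorem runs_emit (P : Params) (hB : 0 < P.B) (u : WithTop K) (n : ℕ) (p : Pair K)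
    (h : Pair.Ok P.B p) (hn : (Pair.upTo u p).length ≤ n) :
    ∃ (bs : List (Block K)) (p' : Pair K),
      Runs (emit P u n p) (bs, (Pair.upTo u p).length, p') (Pair.blocks p - Pair.blocks p')
        bs.length ((Pair.held p' : ℤ) - Pair.held p) (3 * P.B - Pair.held p) ∧
      Pair.Ok P.B p' ∧ Pair.blocks p' ≤ Pair.blocks p ∧
      Pair.merged p = Pair.upTo u p ++ Pair.merged p' ∧ Dense P.B bs ∧
      contentsOf bs = Pair.upTo u p := by
  induction n generalizing p with
  | zero =>
    have e : Pair.upTo u p = [] := List.length_eq_zero_iff.1 (by omega)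
    have h0 := Pair.held_le h
    refine ⟨[], p, ?_, h, le_rfl, by simp [e], dense_nil _, by simp [e]⟩
    rw [e]
    exact (Runs.pure _).mono (by omega) (by simp) (by simp) (by omega)
  | succ n ih =>
    have h0 := Pair.held_le h
    obtain ⟨q, h1, h2, h3, h4⟩ := runs_pullMany u P.B p h
    have h5 := Pair.upTo_of_append h4
    have h10 := Pair.held_le h2
    by_cases he : (Pair.upTo u p).take P.B = []
    · have e : Pair.upTo u p = [] := by
        rcases List.take_eq_nil_iff.1 he with h | h
        · omega
        · exact h
      refine ⟨[], q, ?_, h2, h3, by rw [h4]; simp [e], dense_nil _, by simp [e]⟩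
      have h6 : Runs (if (Pair.upTo u p).take P.B = [] then
          (Pure.pure ([], 0, q) : Prog (List (Block K) × ℕ × Pair K))
        else do
          let b ← store ((Pair.upTo u p).take P.B)
          let r ← emit P u n q
          Pure.pure (b :: r.1, ((Pair.upTo u p).take P.B).length + r.2.1, r.2.2))
          ([], (Pair.upTo u p).length, q) 0 0 0 0 := by
        rw [if_pos he, e]; exact Runs.pure _
      refine Runs.mono (Runs.bind h1 h6) ?_ ?_ ?_ ?_
      all_goals try simp only [he, List.length_nil]
      all_goals omega
    · have h11 : 0 < ((Pair.upTo u p).take P.B).length := List.length_pos_iff.2 he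
      have h12 : ((Pair.upTo u p).take P.B).length + ((Pair.upTo u p).drop P.B).length =
          (Pair.upTo u p).length := by
        rw [← List.length_append, List.take_append_drop]
      have h13 : ((Pair.upTo u p).take P.B).length ≤ P.B := List.length_take_le _ _
      obtain ⟨bs, p', k1, k2, k3, k4, k5, k6⟩ := ih q h2 (by rw [h5]; omega)
      rw [h5] at k1 k4 k6
      refine ⟨⟨(Pair.upTo u p).take P.B⟩ :: bs, p', ?_, k2, by omega, ?_, ?_, ?_⟩
      · have h6 : Runs (if (Pair.upTo u p).take P.B = [] then
            (Pure.pure ([], 0, q) : Prog (List (Block K) × ℕ × Pair K))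
          else do
            let b ← store ((Pair.upTo u p).take P.B)
            let r ← emit P u n q
            Pure.pure (b :: r.1, ((Pair.upTo u p).take P.B).length + r.2.1, r.2.2))
            (⟨(Pair.upTo u p).take P.B⟩ :: bs, (Pair.upTo u p).length, p')
            (Pair.blocks q - Pair.blocks p') (bs.length + 1)
            ((Pair.held p' : ℤ) - Pair.held q - ((Pair.upTo u p).take P.B).length)
            (max 0 (3 * P.B - Pair.held q - ((Pair.upTo u p).take P.B).length)) := by
          have := Pair.held_le k2
          rw [if_neg he, ← h12]
          refine Runs.mono (Runs.bind (runs_storeList _) (Runs.bind k1 (Runs.pure _))) ?_ ?_ ?_ ?_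
          all_goals omega
        refine Runs.mono (Runs.bind h1 h6) ?_ ?_ ?_ ?_
        all_goals try simp only [List.length_cons]
        all_goals omega
      · rw [h4, k4, ← List.append_assoc, List.take_append_drop]
      · rw [dense_cons]
        refine ⟨⟨h11, h13⟩, ?_, k5⟩
        by_cases hb : (Pair.upTo u p).length ≤ P.B
        · left
          rw [List.drop_eq_nil_of_le hb] at k6
          by_contra hne
          obtain ⟨c, cs, rfl⟩ := List.exists_cons_of_ne_nil hne
          have := (dense_cons.1 k5).1.1
          rw [contentsOf_cons] at k6
          simp [(List.append_eq_nil_iff.1 k6).1] at this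
        · right; simp; omega
      · simp [k6]

end Readers
-- Distributing a merge to the children's buffers
section Distribution

variable {K : Type u} [LinearOrder K]

theorem Pair.upTo_top (p : Pair K) : upTo ⊤ p = merged p := by
  rw [upTo, List.takeWhile_eq_self_iff]; simp

theorem runs_mergeFiles (P : Params) (hB : 0 < P.B) (n : ℕ) (as bs : List (Block K))
    (ha : Dense P.B as) (hb : Dense P.B bs)
    (hn : (contentsOf as).length + (contentsOf bs).length ≤ n) :
    ∃ out, Runs (mergeFiles P n as bs) out (as.length + bs.length) out.length 0 (3 * P.B) ∧
      Dense P.B out ∧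
      contentsOf out = List.merge (contentsOf as) (contentsOf bs) fun a b => decide (a ≤ b) := by
  have hm : Pair.merged (Reader.start as, Reader.start bs) =
      List.merge (contentsOf as) (contentsOf bs) fun a b => decide (a ≤ b) := rfl
  obtain ⟨out, p', h1, h2, h3, h4, h5, h6⟩ := runs_emit P hB ⊤ n
    (Reader.start as, Reader.start bs) ⟨Reader.ok_start ha, Reader.ok_start hb⟩
    (by rw [Pair.upTo_top, hm, List.length_merge]; exact hn)
  rw [Pair.upTo_top] at h4 h6
  have h7 := Pair.held_eq_zero (List.append_right_eq_self.1 h4.symm)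
  have h8 : Pair.held (Reader.start as, Reader.start bs) = 0 := rfl
  have h9 : Pair.blocks (Reader.start as, Reader.start bs) = as.length + bs.length := rfl
  refine ⟨out, ?_, h5, h6⟩
  refine Runs.mono (Runs.bind h1 (Runs.pure _)) ?_ ?_ ?_ ?_
  all_goals omega

/-- Two writes may be less than fully paid by new records: the old partial block, read and
rewritten, and the new last block. Hence the term `2 * P.B` and the additional read. -/
theorem runs_appendTo (P : Params) {σ : Type u} (hB : 0 < P.B) (n : ℕ) (v : Node K σ) (p : Pair K)
    (hp : Pair.Ok P.B p) (hv : Dense P.B v.buf) (hs : v.size = (contentsOf v.buf).length)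
    (hn : (Pair.upTo v.upper p).length ≤ n) :
    ∃ (buf : List (Block K)) (p' : Pair K) (w : ℕ),
      Runs (appendTo P n v p)
        ({ v with buf := buf, size := v.size + (Pair.upTo v.upper p).length }, p')
        (1 + (Pair.blocks p - Pair.blocks p')) w ((Pair.held p' : ℤ) - Pair.held p)
        (4 * P.B - Pair.held p) ∧
      w * P.B ≤ (Pair.upTo v.upper p).length + 2 * P.B ∧
      Pair.Ok P.B p' ∧ Pair.blocks p' ≤ Pair.blocks p ∧
      Pair.merged p = Pair.upTo v.upper p ++ Pair.merged p' ∧ Dense P.B buf ∧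
      contentsOf buf = contentsOf v.buf ++ Pair.upTo v.upper p := by
  have h0 := Pair.held_le hp
  -- This covers both ways of having no partial block: an empty buffer, and a size divisible by `B`.
  have plain : (∀ b ∈ v.buf, b.contents.length = P.B) →
      appendTo P n v p = (do
        let r ← emit P v.upper n p
        pure ({ v with buf := v.buf ++ r.1, size := v.size + r.2.1 }, r.2.2)) →
      ∃ (buf : List (Block K)) (p' : Pair K) (w : ℕ),
      Runs (appendTo P n v p)
        ({ v with buf := buf, size := v.size + (Pair.upTo v.upper p).length }, p')
        (1 + (Pair.blocks p - Pair.blocks p')) w ((Pair.held p' : ℤ) - Pair.held p)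
        (4 * P.B - Pair.held p) ∧
      w * P.B ≤ (Pair.upTo v.upper p).length + 2 * P.B ∧
      Pair.Ok P.B p' ∧ Pair.blocks p' ≤ Pair.blocks p ∧
      Pair.merged p = Pair.upTo v.upper p ++ Pair.merged p' ∧ Dense P.B buf ∧
      contentsOf buf = contentsOf v.buf ++ Pair.upTo v.upper p := by
    intro hfull e
    rw [e]
    obtain ⟨bs, p', h1, h2, h3, h4, h5, h6⟩ := runs_emit P hB v.upper n p hp hn
    have h7 := h5.length_mul_le
    have h8 := Pair.held_le h2
    rw [h6] at h7
    refine ⟨v.buf ++ bs, p', bs.length, ?_, by omega, h2, h3, h4, Dense.append hfull hB h5,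
      by rw [contentsOf_append, h6]⟩
    refine Runs.mono (Runs.bind h1 (Runs.pure _)) ?_ ?_ ?_ ?_
    all_goals omega
  rcases hl : v.buf.getLast? with _ | c
  · have e : v.buf = [] := List.getLast?_eq_none_iff.1 hl
    exact plain (by simp [e]) (by simp only [appendTo, hl])
  · obtain ⟨init, e⟩ : ∃ init, v.buf = init ++ [c] := by
      have := List.dropLast_append_getLast? c hl
      exact ⟨_, this.symm⟩
    have hinit : ∀ b ∈ init, b.contents.length = P.B := fun b hb => hv.2 b (by rw [e]; simpa)
    have hc := hv.1 c (by rw [e]; simp)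
    have hs' : v.size = init.length * P.B + c.contents.length := by
      rw [hs, e, contentsOf_append, List.length_append, length_contentsOf hinit]; simp
    rcases hm : v.size % P.B with _ | m
    · refine plain ?_ (by simp only [appendTo, hl, hm])
      have h1 : c.contents.length % P.B = 0 := by
        rw [hs'] at hm; simpa using hm
      have h2 : c.contents.length = P.B :=
        le_antisymm hc.2 (Nat.le_of_dvd hc.1 (Nat.dvd_of_mod_eq_zero h1))
      intro b hb
      rw [e] at hb
      rcases List.mem_append.1 hb with hb | hb
      · exact hinit b hb
      · rw [List.mem_singleton.1 hb]; exact h2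
    · obtain ⟨q, h1, h2, h3, h4⟩ :=
        runs_pullMany v.upper (P.B - c.contents.length) p hp
      have h5 := Pair.upTo_of_append h4
      have h12 : ((Pair.upTo v.upper p).take (P.B - c.contents.length)).length +
          ((Pair.upTo v.upper p).drop (P.B - c.contents.length)).length =
          (Pair.upTo v.upper p).length := by
        rw [← List.length_append, List.take_append_drop]
      have h13 := List.length_take_le (P.B - c.contents.length) (Pair.upTo v.upper p)
      obtain ⟨bs, p', k1, k2, k3, k4, k5, k6⟩ := runs_emit P hB v.upper n q h2
        (by rw [h5]; omega)
      rw [h5] at k1 k4 k6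
      have h7 := k5.length_mul_le
      rw [k6] at h7
      have h8 := Pair.held_le h2
      have h9 := Pair.held_le k2
      refine ⟨init ++ ⟨c.contents ++
        (Pair.upTo v.upper p).take (P.B - c.contents.length)⟩ :: bs, p', bs.length + 1, ?_, ?_, k2,
        by omega, ?_, ?_, ?_⟩
      · have e2 : v.buf.dropLast = init := by rw [e]; simp
        simp only [appendTo, hl, hm, e2]
        rw [← h12]
        refine Runs.mono (Runs.bind (runs_loadList c) (Runs.bind h1 (Runs.bind (runs_storeList _)
          (Runs.bind k1 (Runs.pure _))))) ?_ ?_ ?_ ?_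
        all_goals try simp only [List.length_append]
        all_goals omega
      · rw [Nat.succ_mul]; omega
      · rw [h4, k4, ← List.append_assoc, List.take_append_drop]
      · refine Dense.append hinit hB (dense_cons.2 ⟨?_, ?_, k5⟩)
        · simp only [List.length_append]; omega
        · by_cases hb : (Pair.upTo v.upper p).length ≤ P.B - c.contents.length
          · left
            rw [List.drop_eq_nil_of_le hb] at k6
            by_contra hne
            obtain ⟨d, ds, rfl⟩ := List.exists_cons_of_ne_nil hne
            have := (dense_cons.1 k5).1.1
            rw [contentsOf_cons] at k6
            simp [(List.append_eq_nil_iff.1 k6).1] at this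
          · right; simp; omega
      · rw [e]; simp [k6]

/-- The children `cs'` arise from `cs` by appending to each buffer the records of the sorted list
`Z` that belong to the child. -/
def Distributed (B : ℕ) {σ : Type u} :
    List (Stored (Node K σ)) → List K → List (Stored (Node K σ)) → Prop
  | [], Z, cs' => Z = [] ∧ cs' = []
  | c :: cs, Z, cs' => ∃ (Y Z' : List K) (buf : List (Block K)) (ds : List (Stored (Node K σ))),
      Y = Z.takeWhile (fun z : K => decide ((z : WithTop K) ≤ c.contents.upper)) ∧ Z = Y ++ Z' ∧
      cs' = ⟨{ c.contents with buf := buf, size := c.contents.size + Y.length }⟩ :: ds ∧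
      Dense B buf ∧ contentsOf buf = contentsOf c.contents.buf ++ Y ∧ Distributed B cs Z' ds

/-- Per child there are two extra reads, header and partial block, and three writes not paid by
records: two from `appendTo` and the header. By `hlast` the last child takes all that remains, so
the readers end empty and their memory is free again. -/
theorem runs_distribute (P : Params) {σ : Type u} (hB : 0 < P.B) (n : ℕ)
    (cs : List (Stored (Node K σ))) (p : Pair K) (hp : Pair.Ok P.B p)
    (hc : ∀ c ∈ cs, Dense P.B c.contents.buf ∧
      c.contents.size = (contentsOf c.contents.buf).length)
    (hn : (Pair.merged p).length ≤ n)
    (hlast : ∀ z ∈ Pair.merged p, ∃ c ∈ cs.getLast?, (z : WithTop K) ≤ c.contents.upper) :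
    ∃ (cs' : List (Stored (Node K σ))) (w : ℕ),
      Runs (distribute P n cs p) cs' (2 * cs.length + Pair.blocks p) w (-(Pair.held p : ℤ))
        (1 + 4 * P.B - Pair.held p) ∧
      w * P.B ≤ (Pair.merged p).length + 3 * (cs.length * P.B) ∧
      Distributed P.B cs (Pair.merged p) cs' := by
  induction cs generalizing p with
  | nil =>
    have e : Pair.merged p = [] := List.eq_nil_iff_forall_not_mem.2 fun z hz => by
      simpa using hlast z hz
    have := Pair.held_eq_zero e
    exact ⟨[], 0, (Runs.pure _).mono (by omega) le_rfl (by omega) (by omega), by simp, e, rfl⟩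
  | cons c cs ih =>
    have hY : (Pair.upTo c.contents.upper p).length ≤ (Pair.merged p).length :=
      (List.takeWhile_sublist _).length_le
    obtain ⟨buf, p', w, h1, h2, h3, h4, h5, h6, h7⟩ :=
      runs_appendTo P hB n c.contents p hp (hc c (by simp)).1 (hc c (by simp)).2 (by omega)
    have h8 := congrArg List.length h5
    rw [List.length_append] at h8
    obtain ⟨ds, w', k1, k2, k3⟩ := ih p' h3 (fun d hd => hc d (by simp [hd])) (by omega) (by
      intro z hz
      have hz' : z ∈ Pair.merged p := by rw [h5]; simp [hz]
      obtain ⟨d, hd, hzd⟩ := hlast z hz'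
      cases cs with
      | nil =>
        exfalso
        obtain rfl : c = d := by simpa using hd
        have : Pair.upTo c.contents.upper p = Pair.merged p := by
          rw [Pair.upTo, List.takeWhile_eq_self_iff]
          intro x hx
          obtain ⟨d, hd, hxd⟩ := hlast x hx
          obtain rfl : c = d := by simpa using hd
          simpa using hxd
        rw [this] at h5
        rw [List.append_right_eq_self.1 h5.symm] at hz
        simp at hz
      | cons d' ds' => exact ⟨d, by simpa using hd, hzd⟩)
    have h9 := Pair.held_le h3
    have h10 := Pair.held_le hp
    refine ⟨_, w + w' + 1, ?_, ?_, _, _, buf, ds, rfl, h5, rfl, h6, h7, k3⟩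
    · refine Runs.mono (Runs.bind (runs_loadNode c) (Runs.bind h1 (Runs.bind (runs_storeNode _)
        (Runs.bind k1 (Runs.pure _))))) ?_ ?_ ?_ ?_
      all_goals try simp only [List.length_cons]
      all_goals omega
    · rw [List.length_cons]
      nlinarith

end Distribution
-- Tree invariants and the potential
section Trees

variable {K : Type u}

/-- The records below a list of children. -/
def childRecords (h : ℕ) (cs : List (Stored (Tree K h))) : List K :=
  (cs.map fun c => recordsOf h c.contents).flatten

@[simp] theorem childRecords_nil (h : ℕ) : childRecords h ([] : List (Stored (Tree K h))) = [] :=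
  rfl

@[simp] theorem childRecords_cons (h : ℕ) (c : Stored (Tree K h)) (cs : List (Stored (Tree K h))) :
    childRecords h (c :: cs) = recordsOf h c.contents ++ childRecords h cs := rfl

theorem mem_childRecords {h : ℕ} {cs : List (Stored (Tree K h))} {x : K} :
    x ∈ childRecords h cs ↔ ∃ c ∈ cs, x ∈ recordsOf h c.contents := by
  simp [childRecords]

theorem childRecords_append (h : ℕ) (cs ds : List (Stored (Tree K h))) :
    childRecords h (cs ++ ds) = childRecords h cs ++ childRecords h ds := by
  simp [childRecords]

theorem recordsOf_zero (v : Tree K 0) : recordsOf 0 v = contentsOf v.buf ++ contentsOf v.body := rfl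

theorem recordsOf_succ (h : ℕ) (v : Tree K (h + 1)) :
    recordsOf (h + 1) v = contentsOf v.buf ++ childRecords h v.body := rfl

theorem recordsOf_append_buf {h : ℕ} (v : Tree K h) {buf : List (Block K)} {n : ℕ} {Y : List K}
    (hb : contentsOf buf = contentsOf v.buf ++ Y) :
    (recordsOf h { v with buf := buf, size := n }).Perm (recordsOf h v ++ Y) := by
  cases h with
  | zero =>
    simp only [recordsOf_zero, hb, List.append_assoc]
    exact List.Perm.append_left _ List.perm_append_comm
  | succ h =>
    simp only [recordsOf_succ, hb, List.append_assoc]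
    exact List.Perm.append_left _ List.perm_append_comm

/-- The credit of a subtree: `wt i` for each record in a buffer at height `i`, and `e` for each
emptied node. -/
def credit (wt : ℕ → ℕ) (e : ℕ) : (h : ℕ) → Tree K h → ℕ
  | 0, v => wt 0 * (contentsOf v.buf).length
  | h + 1, v => wt (h + 1) * (contentsOf v.buf).length + (if v.emptied then e else 0) +
      (List.map (fun c : Stored (Tree K h) => credit wt e h c.contents) v.body).sum

theorem credit_append_buf {wt : ℕ → ℕ} {e h : ℕ} (v : Tree K h) {buf : List (Block K)} {n : ℕ}
    {Y : List K} (hb : contentsOf buf = contentsOf v.buf ++ Y) :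
    credit wt e h { v with buf := buf, size := n } = credit wt e h v + wt h * Y.length := by
  cases h with
  | zero => simp only [credit, hb, List.length_append]; ring
  | succ h => simp only [credit, hb, List.length_append]; ring

variable [LinearOrder K]

/-- The keys separate the subtrees. -/
def Separated (h : ℕ) (cs : List (Stored (Tree K h))) : Prop :=
  List.Pairwise (fun c d : Stored (Tree K h) => c.contents.upper < d.contents.upper ∧
    ∀ x ∈ recordsOf h d.contents, c.contents.upper < (x : WithTop K)) cs

/-- The buffer is dense, and sorted beyond the first `lB` records. -/
def BufferOK (l B : ℕ) {σ : Type u} (v : Node K σ) : Prop :=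
  Dense B v.buf ∧ v.size = (contentsOf v.buf).length ∧
    ((contentsOf v.buf).drop (l * B)).Pairwise (· < ·)

/-- What is required of a leaf apart from its buffer. -/
def LeafShape (l B : ℕ) (isRoot : Bool) (v : Tree K 0) : Prop :=
  (∀ x ∈ recordsOf 0 v, (x : WithTop K) ≤ v.upper) ∧
  Dense B v.body ∧ (contentsOf v.body).Pairwise (· < ·) ∧
  List.length v.body ≤ l ∧ (contentsOf v.body).length ≤ l * B ∧
  (isRoot = false → l * B ≤ 4 * (contentsOf v.body).length)

/-- What is required of an internal node apart from its buffer and the state of its children. -/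
def InternalShape (l h : ℕ) (isRoot : Bool) (v : Tree K (h + 1)) : Prop :=
  (∀ x ∈ recordsOf (h + 1) v, (x : WithTop K) ≤ v.upper) ∧
  List.length v.body ≤ l ∧ 2 ≤ List.length v.body ∧
  (isRoot = false → l ≤ 4 * List.length v.body) ∧
  Separated h v.body ∧
  (∀ c ∈ List.getLast? (v.body : List (Stored (Tree K h))), c.contents.upper = v.upper)

/-- A node in order but for its buffer, which may be full. -/
def Receiving (l B : ℕ) : (h : ℕ) → (isRoot : Bool) → Tree K h → Prop
  | 0, isRoot, v => BufferOK l B v ∧ LeafShape l B isRoot v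
  | h + 1, isRoot, v => BufferOK l B v ∧ v.emptied = false ∧ InternalShape l h isRoot v ∧
      ∀ c ∈ (v.body : List (Stored (Tree K h))), NodeOK l B h false c.contents

/-- A node after the first phase of a buffer-emptying process. -/
def Drained (l B : ℕ) : (h : ℕ) → (isRoot : Bool) → Tree K h → Prop
  | 0, isRoot, v => Receiving l B 0 isRoot v
  | h + 1, isRoot, v => NodeOK l B (h + 1) isRoot v ∨
      v.emptied = true ∧ v.buf = [] ∧ InternalShape l h isRoot v ∧
        ∀ c ∈ (v.body : List (Stored (Tree K h))), Drained l B h false c.contents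

/-- The sortedness demanded by `Receiving` concerns only records beyond the first `lB`, so it is
vacuous for a node that is not full. -/
theorem nodeOK_iff {l B h : ℕ} {isRoot : Bool} {v : Tree K h} :
    NodeOK l B h isRoot v ↔ Receiving l B h isRoot v ∧ v.size < l * B := by
  cases h with
  | zero =>
    constructor
    · rintro ⟨h1, h2, h3, h4, h5⟩
      refine ⟨⟨⟨h1, h2, ?_⟩, h4, h5⟩, h3⟩
      rw [List.drop_eq_nil_of_le (by omega)]; exact List.Pairwise.nil
    · rintro ⟨⟨⟨h1, h2, -⟩, h4, h5⟩, h3⟩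
      exact ⟨h1, h2, h3, h4, h5⟩
  | succ h =>
    constructor
    · rintro ⟨h1, h2, h3, h4, h5, h6, h7, h8, h9, h10, h11⟩
      refine ⟨⟨⟨h1, h2, ?_⟩, h5, ⟨h4, h6, h7, h8, h10, h11⟩, h9⟩, h3⟩
      rw [List.drop_eq_nil_of_le (by omega)]; exact List.Pairwise.nil
    · rintro ⟨⟨⟨h1, h2, -⟩, h5, ⟨h4, h6, h7, h8, h10, h11⟩, h9⟩, h3⟩
      exact ⟨h1, h2, h3, h4, h5, h6, h7, h8, h9, h10, h11⟩

theorem NodeOK.bufferOK {l B h : ℕ} {isRoot : Bool} {v : Tree K h} (hv : NodeOK l B h isRoot v) :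
    BufferOK l B v := by
  have := (nodeOK_iff.1 hv).1
  cases h with
  | zero => exact this.1
  | succ h => exact this.1

theorem NodeOK.le_upper {l B h : ℕ} {isRoot : Bool} {v : Tree K h} (hv : NodeOK l B h isRoot v) :
    ∀ x ∈ recordsOf h v, (x : WithTop K) ≤ v.upper := by
  cases h with
  | zero => exact hv.2.2.2.1
  | succ h => exact hv.2.2.2.1

theorem NodeOK.append_buf {l B h : ℕ} {isRoot : Bool} {v : Tree K h} (hv : NodeOK l B h isRoot v)
    {buf : List (Block K)} {Y : List K} (hd : Dense B buf)
    (hb : contentsOf buf = contentsOf v.buf ++ Y)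
    (hs : ((contentsOf v.buf ++ Y).drop (l * B)).Pairwise (· < ·))
    (hY : ∀ y ∈ Y, (y : WithTop K) ≤ v.upper) :
    Receiving l B h isRoot { v with buf := buf, size := v.size + Y.length } := by
  have h1 := hv.bufferOK
  have h3 : BufferOK l B ({ v with buf := buf, size := v.size + Y.length } : Tree K h) := by
    refine ⟨hd, by simp [hb, h1.2.1], ?_⟩
    simpa only [hb] using hs
  have h4 : ∀ x ∈ recordsOf h ({ v with buf := buf, size := v.size + Y.length } : Tree K h),
      (x : WithTop K) ≤ v.upper := by
    intro x hx
    rcases List.mem_append.1 ((recordsOf_append_buf v hb).mem_iff.1 hx) with hx | hx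
    exacts [hv.le_upper x hx, hY x hx]
  cases h with
  | zero =>
    obtain ⟨⟨-, -, h6⟩, -⟩ := nodeOK_iff.1 hv
    exact ⟨h3, h4, h6⟩
  | succ h =>
    obtain ⟨⟨-, h5, ⟨-, h6⟩, h7⟩, -⟩ := nodeOK_iff.1 hv
    exact ⟨h3, h5, ⟨h4, h6⟩, h7⟩

/-- Each child receives one sorted batch, lying between the bound of its predecessor and its own;
thus separation survives, bounds are unchanged, and each record of `Z` gains the weight of the
children's height. -/
theorem Distributed.spec {l B h e : ℕ} {wt : ℕ → ℕ} {cs cs' : List (Stored (Tree K h))} {Z : List K}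
    (hd : Distributed B cs Z cs') (hc : ∀ c ∈ cs, NodeOK l B h false c.contents)
    (hsep : Separated h cs) (hZ : Z.Pairwise (· < ·)) :
    (∀ c ∈ cs', Receiving l B h false c.contents) ∧ Separated h cs' ∧
      cs'.map (fun c => c.contents.upper) = cs.map (fun c => c.contents.upper) ∧
      (childRecords h cs').Perm (childRecords h cs ++ Z) ∧
      (cs'.map fun c => credit wt e h c.contents).sum =
        (cs.map fun c => credit wt e h c.contents).sum + wt h * Z.length := by
  induction cs generalizing Z cs' with
  | nil =>
    obtain ⟨rfl, rfl⟩ := hd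
    simp [Separated]
  | cons c cs ih =>
    obtain ⟨Y, Z', buf, ds, hY, hZ', rfl, hbuf, hbuf', hds⟩ := hd
    rw [Separated, List.pairwise_cons] at hsep
    have hZs := List.pairwise_append.1 (hZ' ▸ hZ)
    obtain ⟨h1, h2, h3, h4, h5⟩ := ih hds (fun d hd => hc d (by simp [hd])) hsep.2 hZs.2.1
    have hYu : ∀ y ∈ Y, (y : WithTop K) ≤ c.contents.upper := fun y hy => by
      rw [hY] at hy
      simpa using List.mem_takeWhile_imp hy
    -- The first record not taken exceeds the bound, and `Z` is increasing.
    have hZu : ∀ z ∈ Z', c.contents.upper < (z : WithTop K) := by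
      have e1 : Z' = Z.dropWhile (fun z : K => decide ((z : WithTop K) ≤ c.contents.upper)) := by
        have := List.takeWhile_append_dropWhile
          (p := fun z : K => decide ((z : WithTop K) ≤ c.contents.upper)) (l := Z)
        rw [← hY] at this
        exact (List.append_cancel_left (this.trans hZ')).symm
      rcases eZ : Z' with _ | ⟨y, ys⟩
      · simp
      · have hy : c.contents.upper < (y : WithTop K) := by
          have hne : Z.dropWhile (fun z : K => decide ((z : WithTop K) ≤ c.contents.upper)) ≠ [] := by
            rw [← e1, eZ]; simp
          have := List.head_dropWhile_not
            (fun z : K => decide ((z : WithTop K) ≤ c.contents.upper)) hne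
          simp only [← e1, eZ, List.head_cons] at this
          simpa using this
        intro z hz
        rcases List.mem_cons.1 hz with rfl | hz
        · exact hy
        · have := hZs.2.1
          rw [eZ, List.pairwise_cons] at this
          exact hy.trans (WithTop.coe_lt_coe.2 (this.1 z hz))
    refine ⟨?_, ?_, ?_, ?_, ?_⟩
    · intro d hd
      rcases List.mem_cons.1 hd with rfl | hd
      · have hcc := hc c (by simp)
        refine hcc.append_buf hbuf hbuf' ?_ hYu
        -- The old buffer has fewer than `lB` records, so whatever lies beyond the first `lB`
        -- belongs to the sorted batch.
        rw [List.drop_append, List.drop_eq_nil_of_le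
          (by rw [← hcc.bufferOK.2.1]; exact (nodeOK_iff.1 hcc).2.le), List.nil_append]
        exact hZs.1.drop
      · exact h1 d hd
    · rw [Separated, List.pairwise_cons]
      refine ⟨fun d hd => ⟨?_, fun x hx => ?_⟩, h2⟩
      · have : d.contents.upper ∈ cs.map (fun c => c.contents.upper) := by
          rw [← h3]; exact List.mem_map_of_mem hd
        obtain ⟨d', hd', e'⟩ := List.mem_map.1 this
        rw [← e']
        exact (hsep.1 d' hd').1
      · have := h4.mem_iff.1 (mem_childRecords.2 ⟨d, hd, hx⟩)
        rcases List.mem_append.1 this with hx | hx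
        · obtain ⟨d', hd', hx'⟩ := mem_childRecords.1 hx
          exact (hsep.1 d' hd').2 x hx'
        · exact hZu x hx
    · simp [h3]
    · rw [childRecords_cons, childRecords_cons, hZ']
      refine ((recordsOf_append_buf c.contents hbuf').append h4).trans ?_
      simp only [List.append_assoc]
      refine List.Perm.append_left _ ?_
      rw [← List.append_assoc, ← List.append_assoc]
      exact List.Perm.append_right _ List.perm_append_comm
    · simp only [List.map_cons, List.sum_cons, h5, credit_append_buf c.contents hbuf', hZ',
        List.length_append]
      ring

end Trees
/-- The parameters of a buffer tree. -/
structure Params.Valid (P : Params) : Prop where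
  one_le_k : 1 ≤ P.k
  one_le_B : 1 ≤ P.B
  dvd : P.B ∣ P.M
  le_l : 8 ≤ P.l

namespace Params.Valid

variable {P : Params}

theorem l_eq (hP : P.Valid) : P.l = P.k * (P.M / P.B) := Nat.mul_div_assoc _ hP.dvd

theorem l_mul_B (hP : P.Valid) : P.l * P.B = P.k * P.M := by
  rw [hP.l_eq, mul_assoc, Nat.div_mul_cancel hP.dvd]

theorem M_pos (hP : P.Valid) : 0 < P.M := by
  rcases Nat.eq_zero_or_pos P.M with h | h
  · have := hP.le_l
    simp [Params.l, h] at this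
  · exact h

theorem B_le_M (hP : P.Valid) : P.B ≤ P.M := Nat.le_of_dvd hP.M_pos hP.dvd

theorem B_le (hP : P.Valid) : 8 * P.B ≤ P.l * P.B := Nat.mul_le_mul_right _ hP.le_l

end Params.Valid

/-! ### Summing costs over the children -/

section Loops

theorem sum_map_add_le {α β : Type u} {g : α → β} {w f : α → ℕ} {f' : β → ℕ} {B : ℕ} (as : List α)
    (h : ∀ a ∈ as, B * w a + f' (g a) ≤ f a + B) :
    B * (as.map w).sum + ((as.map g).map f').sum ≤ (as.map f).sum + as.length * B := by
  induction as with
  | nil => simp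
  | cons a as ih =>
    have h1 := ih fun b hb => h b (by simp [hb])
    have h2 := h a (by simp)
    simp only [List.map_cons, List.sum_cons, List.length_cons]
    nlinarith

/-- A loop over programs that leave the occupancy unchanged, with a relation between each input
and its output and cost. -/
theorem exists_runs_forEach {α β : Type u} {f : α → Prog β} {R : α → β → ℕ → Prop} {k : ℕ} {pk : ℤ}
    (hpk : 0 ≤ pk) (as : List α)
    (h : ∀ a ∈ as, ∃ b w, Runs (f a) b (k * w) w 0 pk ∧ R a b w) :
    ∃ (g : α → β) (w : α → ℕ),
      Runs (forEach f as) (as.map g) (k * (as.map w).sum) (as.map w).sum 0 pk ∧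
        ∀ a ∈ as, R a (g a) (w a) := by
  -- The outcome does not depend on the meter, so running from `Meter.zero` names it; membership is
  -- put under the existential to let `choose` produce a total function.
  have h1 : ∀ a, ∃ w, a ∈ as → Runs (f a) (f a Meter.zero).1 (k * w) w 0 pk ∧
      R a (f a Meter.zero).1 w := by
    intro a
    by_cases ha : a ∈ as
    · obtain ⟨b, w, hr, hR⟩ := h a ha
      obtain rfl := (hr Meter.zero).1
      exact ⟨w, fun _ => ⟨hr, hR⟩⟩
    · exact ⟨0, fun h => absurd h ha⟩
  choose w hw using h1
  exact ⟨fun a => (f a Meter.zero).1, w, runs_forEach hpk as fun a ha => (hw a ha).1,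
    fun a ha => (hw a ha).2⟩

end Loops

/-! ### First phase: emptying full internal nodes -/

section FirstPhase

variable {K : Type u}

theorem childRecords_map_perm {h : ℕ} {cs : List (Stored (Tree K h))}
    {g : Stored (Tree K h) → Stored (Tree K h)}
    (hr : ∀ c ∈ cs, (recordsOf h (g c).contents).Perm (recordsOf h c.contents)) :
    (childRecords h (cs.map g)).Perm (childRecords h cs) := by
  induction cs with
  | nil => simp
  | cons c cs ih =>
    simp only [List.map_cons, childRecords_cons]
    exact (hr c (by simp)).append (ih fun d hd => hr d (by simp [hd]))

theorem nodup_of_mem_childRecords {h : ℕ} {cs : List (Stored (Tree K h))}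
    (hn : (childRecords h cs).Nodup) {c : Stored (Tree K h)} (hc : c ∈ cs) :
    (recordsOf h c.contents).Nodup :=
  (List.nodup_flatten.1 hn).1 _ (List.mem_map_of_mem hc)

variable [LinearOrder K]

theorem pairwise_lt_merge {xs ys : List K} (hx : xs.Pairwise (· ≤ ·)) (hy : ys.Pairwise (· ≤ ·))
    (hnd : (xs ++ ys).Nodup) :
    (List.merge xs ys fun a b => decide (a ≤ b)).Pairwise (· < ·) := by
  have h1 : (List.merge xs ys fun a b => decide (a ≤ b)).Pairwise (· ≤ ·) :=
    List.Pairwise.merge hx hy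
  have h2 : (List.merge xs ys fun a b => decide (a ≤ b)).Nodup :=
    (List.merge_perm_append _).nodup_iff.2 hnd
  exact (h1.and h2).imp fun h => lt_of_le_of_ne h.1 h.2

/-- Sorting the first `lB` records of a full buffer. -/
theorem runs_sortBuffer {P : Params} (hP : P.Valid) {σ : Type u} (v : Node K σ)
    (hv : BufferOK P.l P.B v) (hfull : P.l * P.B ≤ v.size) (hnd : (contentsOf v.buf).Nodup) :
    ∃ s, Runs (selectionSort P P.k ⊥ (v.buf.take P.l)) s (P.k * P.l) P.l 0 (P.M + P.B) ∧
      Dense P.B s ∧ Dense P.B (v.buf.drop P.l) ∧ s.length + (v.buf.drop P.l).length = v.buf.length ∧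
      ((contentsOf s) ++ contentsOf (v.buf.drop P.l)).Perm (contentsOf v.buf) ∧
      (List.merge (contentsOf s) (contentsOf (v.buf.drop P.l)) fun a b => decide (a ≤ b)).Pairwise
        (· < ·) := by
  obtain ⟨hd, hs, hsort⟩ := hv
  have hB := hP.one_le_B
  obtain ⟨h1, h2⟩ := hd.take_full hB (n := P.l) (by omega)
  have e := List.take_append_drop P.l v.buf
  have hc : contentsOf (v.buf.take P.l) ++ contentsOf (v.buf.drop P.l) = contentsOf v.buf := by
    rw [← contentsOf_append, e]
  have hlen : (contentsOf (v.buf.take P.l)).length = P.l * P.B := by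
    rw [length_contentsOf h2, h1]
  have hdrop : contentsOf (v.buf.drop P.l) = (contentsOf v.buf).drop (P.l * P.B) := by
    rw [← hc, ← hlen, List.drop_left]
  have hfilter : ((contentsOf (v.buf.take P.l)).filter fun x : K => (⊥ : WithBot K) < (x : WithBot K))
      = contentsOf (v.buf.take P.l) := by
    rw [List.filter_eq_self]; simp
  have hnd1 : (contentsOf (v.buf.take P.l)).Nodup := by
    rw [← hc] at hnd; exact hnd.of_append_left
  -- The first `l` blocks are full, so they hold exactly `lB = kM` records and `k` phases sort them.
  obtain ⟨s, k1, k2, k3⟩ := runs_selectionSort P hB hP.M_pos hP.dvd (v.buf.take P.l)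
    (fun b hb => (h2 b hb).le) hnd1 P.k ⊥ (by rw [hfilter, hlen, hP.l_mul_B])
  rw [hfilter] at k3
  have hperm : ((contentsOf s) ++ contentsOf (v.buf.drop P.l)).Perm (contentsOf v.buf) := by
    rw [← hc, k3]
    exact (List.perm_insertionSort _ _).append_right _
  have hslen : s.length = P.l := by
    have h3 := length_contentsOf k2
    rw [k3, List.length_insertionSort, hlen] at h3
    exact (Nat.eq_of_mul_eq_mul_right hB h3).symm
  refine ⟨s, ?_, ?_, Dense.of_append_right (e.symm ▸ hd), ?_, hperm, pairwise_lt_merge ?_ ?_ ?_⟩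
  · rw [h1, ← hP.l_eq] at k1
    exact k1
  · rw [← List.append_nil s]; exact Dense.append k2 hB (dense_nil _)
  · conv_rhs => rw [← e]
    rw [List.length_append, h1, hslen]
  · rw [k3]; exact List.pairwise_insertionSort _ _
  · rw [hdrop]; exact hsort.imp le_of_lt
  · exact hperm.nodup_iff.2 hnd

theorem Separated.map {h h' : ℕ} {cs : List (Stored (Tree K h))}
    {g : Stored (Tree K h) → Stored (Tree K h')} (hs : Separated h cs)
    (hu : ∀ c ∈ cs, (g c).contents.upper = c.contents.upper)
    (hr : ∀ c ∈ cs, ∀ x ∈ recordsOf h' (g c).contents, x ∈ recordsOf h c.contents) :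
    Separated h' (cs.map g) := by
  rw [Separated, List.pairwise_map]
  refine List.Pairwise.imp_of_mem ?_ hs
  intro c d hc hd hcd
  rw [hu c hc, hu d hd]
  exact ⟨hcd.1, fun x hx => hcd.2 x (hr d hd x hx)⟩

/-- A full node hands its records down; the drop of 13 in their weight pays for the move and for the
mark it leaves. The clause on `buf` is for the root, whose blocks must all be full, which is more
than density. -/
theorem runs_emptyDown {P : Params} (hP : P.Valid) {wt : ℕ → ℕ} (hwt : ∀ h, wt h + 13 ≤ wt (h + 1))
    (h : ℕ) (isRoot : Bool) (c : Stored (Tree K h)) (hc : Receiving P.l P.B h isRoot c.contents)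
    (hnd : (recordsOf h c.contents).Nodup) :
    ∃ c' w, Runs (emptyDown P h c) c' (P.k * w) w 0 (P.M + 6 * P.B) ∧
      Drained P.l P.B h isRoot c'.contents ∧ c'.contents.upper = c.contents.upper ∧
      (c'.contents.buf = [] ∨ c'.contents.buf = c.contents.buf) ∧
      (recordsOf h c'.contents).Perm (recordsOf h c.contents) ∧
      P.B * w + credit wt (3 * (P.l * P.B)) h c'.contents ≤
        credit wt (3 * (P.l * P.B)) h c.contents + P.B := by
  have hB := hP.one_le_B
  have hk := hP.one_le_k
  induction h generalizing isRoot with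
  | zero =>
    refine ⟨c, 0, (Runs.pure _).mono (by omega) le_rfl rfl (by omega), hc, rfl, Or.inr rfl, List.Perm.refl _,
      by omega⟩
  | succ h ih =>
    by_cases hfull : c.contents.size < P.l * P.B
    · refine ⟨c, 1, ?_, Or.inl (nodeOK_iff.2 ⟨hc, hfull⟩), rfl, Or.inr rfl, List.Perm.refl _, by omega⟩
      simp only [emptyDown]
      refine Runs.mono (Runs.bind (runs_loadNode c)
        (r2 := 0) (w2 := 0) (d2 := -1) (pk2 := 0) ?_) ?_ ?_ ?_ ?_
      · rw [if_pos hfull]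
        exact Runs.mono (Runs.bind (runs_release 1) (Runs.pure _)) le_rfl le_rfl rfl (by omega)
      all_goals omega
    · obtain ⟨hbuf, hem, hshape, hch⟩ := hc
      obtain ⟨hle, hlen, hlen2, hlen4, hsep, hlast⟩ := hshape
      generalize hv : c.contents = v at *
      rw [recordsOf_succ] at hnd
      obtain ⟨s, k1, k2, k3, k4, k5, k6⟩ :=
        runs_sortBuffer hP v hbuf (by omega) hnd.of_append_left
      set p : Pair K := (Reader.start s, Reader.start (v.buf.drop P.l)) with hp
      have hm : Pair.merged p = List.merge (contentsOf s) (contentsOf (v.buf.drop P.l))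
        fun a b => decide (a ≤ b) := rfl
      have hmp : (Pair.merged p).Perm (contentsOf v.buf) := by
        rw [hm]; exact (List.merge_perm_append _).trans k5
      have hheld : Pair.held p = 0 := rfl
      have hblocks : Pair.blocks p = v.buf.length := k4
      have hmlen : (Pair.merged p).length = v.size := by rw [hmp.length_eq, hbuf.2.1]
      obtain ⟨cs, wd, d1, d2, d3⟩ := runs_distribute P hB v.size v.body p
        ⟨Reader.ok_start k2, Reader.ok_start k3⟩
        (fun c hc => ⟨(hch c hc).bufferOK.1, (hch c hc).bufferOK.2.1⟩) hmlen.le (by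
          intro z hz
          obtain ⟨d, hd⟩ : ∃ d, List.getLast? (v.body : List (Stored (Tree K h))) = some d := by
            rcases e : List.getLast? (v.body : List (Stored (Tree K h))) with _ | d
            · rw [List.getLast?_eq_none_iff] at e
              rw [e] at hlen2; simp at hlen2
            · exact ⟨d, rfl⟩
          refine ⟨d, hd, ?_⟩
          rw [hlast d hd]
          exact hle z (by rw [recordsOf_succ]; exact List.mem_append_left _ (hmp.mem_iff.1 hz)))
      rw [hheld] at d1
      obtain ⟨e1, e2, e3, e4, e5⟩ := d3.spec (e := 3 * (P.l * P.B)) (wt := wt) hch hsep (hm ▸ k6)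
      have hcslen : cs.length = List.length v.body := by
        simpa using congrArg List.length e3
      have hperm1 : (childRecords h cs).Perm (recordsOf (h + 1) v) := by
        rw [recordsOf_succ]
        exact e4.trans ((hmp.append_left _).trans List.perm_append_comm)
      have hnd' : (childRecords h cs).Nodup := by
        rw [hperm1.nodup_iff, recordsOf_succ]; exact hnd
      obtain ⟨g, w, f1, f2⟩ := exists_runs_forEach (f := emptyDown P h) (k := P.k)
        (pk := P.M + 6 * P.B) (by omega) cs (fun c hc => ih false c (e1 c hc)
          (nodup_of_mem_childRecords hnd' hc))
      have hperm2 := childRecords_map_perm fun c hc => (f2 c hc).2.2.2.1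
      refine ⟨⟨{ v with buf := [], size := 0, emptied := true, body := cs.map g }⟩,
        (2 + P.l + 2 * List.length v.body + v.buf.length + wd) + (cs.map w).sum, ?_, ?_, rfl,
        Or.inl rfl, ?_, ?_⟩
      · simp only [emptyDown]
        refine Runs.mono (Runs.bind (runs_loadNode c) (r2 := 1 + P.k * P.l +
          2 * List.length v.body + v.buf.length + P.k * (cs.map w).sum)
          (w2 := P.l + wd + 2 + (cs.map w).sum)
          (d2 := -1) (pk2 := P.M + 6 * P.B - 1) ?_) ?_ ?_ ?_ ?_
        · rw [hv, if_neg hfull]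
          refine Runs.mono (Runs.bind k1 (Runs.bind d1 (Runs.bind runs_save (Runs.bind f1
            (Runs.bind runs_restore (runs_storeNode _)))))) ?_ ?_ ?_ ?_
          all_goals try rw [hblocks]
          all_goals omega
        · have : (2 + P.l + 2 * List.length v.body + v.buf.length + wd) + (cs.map w).sum =
            P.l + (cs.map w).sum + (2 + 2 * List.length v.body + v.buf.length + wd) := by ring
          rw [this, mul_add, mul_add]
          have := Nat.le_mul_of_pos_left (2 + 2 * List.length v.body + v.buf.length + wd) hk
          omega
        all_goals omega
      · have hbody : (childRecords h (cs.map g)).Perm (recordsOf (h + 1) v) := hperm2.trans hperm1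
        refine Or.inr ⟨rfl, rfl, ⟨?_, ?_, ?_, ?_, ?_, ?_⟩, ?_⟩
        · intro x hx
          exact hle x (hbody.mem_iff.1 hx)
        · simpa [hcslen] using hlen
        · simpa [hcslen] using hlen2
        · simpa [hcslen] using hlen4
        · exact e2.map (fun c hc => (f2 c hc).2.1) fun c hc x hx => (f2 c hc).2.2.2.1.mem_iff.1 hx
        · have e6 : (cs.map g).map (fun c => c.contents.upper) =
              List.map (fun c => c.contents.upper) (v.body : List (Stored (Tree K h))) := by
            rw [← e3, List.map_map]
            exact List.map_congr_left fun c hc => (f2 c hc).2.1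
          intro d hd
          have e7 : d.contents.upper ∈
              ((cs.map g).map (fun c => c.contents.upper)).getLast? := by
            rw [List.getLast?_map]; exact Option.mem_map_of_mem _ hd
          rw [e6, List.getLast?_map] at e7
          obtain ⟨d', hd', e8⟩ := Option.mem_map.1 e7
          rw [← e8]
          exact hlast d' hd'
        · intro d hd
          obtain ⟨c, hc, rfl⟩ := List.mem_map.1 hd
          exact (f2 c hc).1
      · exact hperm2.trans hperm1
      -- In units of `B` per transfer: `2B` for header and work list, `lB` for sorting, `2lB` for
      -- reading headers and partial blocks, `size + B` for the merge, `size + 3lB` for writing,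
      -- `lB` for the spare `B` of each child, and `3lB` for the mark. That is `2 size + 10lB + 3B`,
      -- at most `13 size + B` since `8B ≤ lB ≤ size`.
      · have h1 := sum_map_add_le (B := P.B) (f := fun c : Stored (Tree K h) => credit wt (3 * (P.l * P.B)) h c.contents)
          (f' := fun c : Stored (Tree K h) => credit wt (3 * (P.l * P.B)) h c.contents) cs fun c hc => (f2 c hc).2.2.2.2
        rw [e5, hcslen, hmlen] at h1
        have h2 := hbuf.1.length_mul_le
        rw [← hbuf.2.1] at h2
        rw [hmlen] at d2
        have h3 : List.length v.body * P.B ≤ P.l * P.B := Nat.mul_le_mul_right _ hlen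
        have h4 := hP.B_le
        have h5 := Nat.mul_le_mul_right v.size (hwt h)
        simp only [credit, hem, contentsOf_nil, List.length_nil, ← hbuf.2.1] at h1 ⊢
        simp only [if_true, Bool.false_eq_true, if_false]
        rw [add_mul] at h5
        have h6 : P.B * (2 + P.l + 2 * List.length v.body + v.buf.length + wd + (cs.map w).sum) =
          2 * P.B + P.l * P.B + 2 * (List.length v.body * P.B) + v.buf.length * P.B + wd * P.B +
            P.B * (cs.map w).sum := by ring
        rw [h6]
        omega

end FirstPhase
-- Cutting a list of entries into nodes
section Splitting

/-- A part of length `⌊|xs| / t⌋` is within any integer bounds that the average respects, and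
removing it keeps the average of the rest within the same bounds. -/
theorem parts_spec {α : Type u} (t : ℕ) (xs : List α) (a b : ℕ) (ha : a * t ≤ xs.length)
    (hb : xs.length ≤ b * t) :
    (parts t xs).flatten = xs ∧ (parts t xs).length = t ∧
      ∀ g ∈ parts t xs, a ≤ g.length ∧ g.length ≤ b := by
  induction t generalizing xs with
  | zero =>
    have : xs = [] := List.length_eq_zero_iff.1 (by simpa using hb)
    simp [parts, this]
  | succ t ih =>
    set q := xs.length / (t + 1) with hq
    have h1 : q * (t + 1) ≤ xs.length := Nat.div_mul_le_self _ _
    have h2 : xs.length < (q + 1) * (t + 1) := by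
      rw [hq, mul_comm]; exact Nat.lt_mul_div_succ _ (Nat.succ_pos t)
    have h3 : a ≤ q := (Nat.le_div_iff_mul_le (Nat.succ_pos t)).2 ha
    have h4 : q ≤ b := Nat.div_le_of_le_mul (by rw [mul_comm]; exact hb)
    have h5 : q ≤ xs.length := Nat.div_le_self _ _
    have h6 : a * t ≤ q * t := Nat.mul_le_mul_right _ h3
    have h7 : (xs.drop q).length ≤ b * t := by
      rw [List.length_drop]
      rcases h4.eq_or_lt with h | h
      · rw [h]; rw [Nat.mul_succ] at hb; omega
      · have : (q + 1) * t ≤ b * t := Nat.mul_le_mul_right _ h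
        rw [Nat.mul_succ] at h2
        omega
    obtain ⟨k1, k2, k3⟩ := ih (xs.drop q) (by
      rw [List.length_drop]; rw [Nat.mul_succ] at h1; omega) h7
    refine ⟨?_, ?_, ?_⟩
    · simp only [parts, List.flatten_cons, ← hq]; rw [k1, List.take_append_drop]
    · simp only [parts, List.length_cons, ← hq]; rw [k2]
    · intro g hg
      simp only [parts, List.mem_cons, ← hq] at hg
      rcases hg with rfl | hg
      · rw [List.length_take, min_eq_left h5]; exact ⟨h3, h4⟩
      · exact k3 g hg

variable {K α : Type u}

/-- The key of the last entry of a list of cells, or `u`. -/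
def endKey (key : α → WithTop K) (u : WithTop K) (g : List (Stored α)) : WithTop K :=
  g.getLast?.elim u fun c => key c.contents

theorem runs_copy [Footprint α] (key : α → WithTop K) (u : WithTop K) (g : List (Stored α)) {b : ℕ}
    (hb : ∀ c ∈ g, Footprint.words c.contents ≤ b) :
    Runs (copy key u g) (endKey key u g, g) g.length g.length 0 b := by
  induction g generalizing u with
  | nil => exact (Runs.pure _).mono le_rfl le_rfl rfl (by omega)
  | cons c g ih =>
    have h1 := hb c (by simp)
    have e : endKey key u (c :: g) = endKey key (key c.contents) g := by
      simp only [endKey, List.getLast?_cons]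
      cases g.getLast? <;> rfl
    rw [e]
    refine Runs.mono (Runs.bind (runs_load c) (Runs.bind (runs_store _)
      (Runs.bind (ih (key c.contents) fun d hd => hb d (by simp [hd])) (Runs.pure _)))) ?_ ?_ ?_ ?_
    all_goals try simp only [List.length_cons]
    all_goals omega

/-- The nodes with the given lists of entries; each is bounded by its last key, the last one
by `u`. -/
def cutNodes (key : α → WithTop K) (u : WithTop K) :
    List (List (Stored α)) → List (Stored (Node K (List (Stored α))))
  | [] => []
  | [g] => [⟨⟨u, [], 0, false, g⟩⟩]
  | g :: gs => ⟨⟨endKey key ⊤ g, [], 0, false, g⟩⟩ :: cutNodes key u gs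

theorem runs_makeNodes [Footprint α] (key : α → WithTop K) (u : WithTop K)
    (gs : List (List (Stored α))) {b : ℕ} (hb1 : 1 ≤ b)
    (hb : ∀ c ∈ gs.flatten, Footprint.words c.contents ≤ b) :
    Runs (makeNodes key u gs) (cutNodes key u gs) gs.flatten.length (gs.flatten.length + gs.length)
      0 b := by
  induction gs with
  | nil => exact (Runs.pure _).mono (by simp) (by simp) rfl (by omega)
  | cons g gs ih =>
    have h1 := runs_copy key ⊤ g fun c hc => hb c (by simp [hc])
    have h2 := ih fun c hc => hb c (by
      rw [List.flatten_cons]; exact List.mem_append_right _ hc)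
    cases gs with
    | nil =>
      refine Runs.mono (Runs.bind h1 (Runs.bind (runs_occupy 1) (Runs.bind (runs_storeNode _)
        (Runs.pure _)))) ?_ ?_ ?_ ?_
      all_goals try simp only [List.flatten_cons, List.flatten_nil, List.append_nil,
        List.length_cons, List.length_nil]
      all_goals omega
    | cons g' gs =>
      have e1 : (g :: g' :: gs).flatten.length = g.length + (g' :: gs).flatten.length := by
        rw [List.flatten_cons, List.length_append]
      have e2 : (g :: g' :: gs).length = (g' :: gs).length + 1 := rfl
      rw [e1, e2]
      refine Runs.mono (Runs.bind h1 (Runs.bind (runs_occupy 1) (Runs.bind (runs_storeNode _)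
        (Runs.bind h2 (Runs.pure _))))) ?_ ?_ ?_ ?_
      all_goals omega

theorem body_cutNodes (key : α → WithTop K) (u : WithTop K) (gs : List (List (Stored α))) :
    (cutNodes key u gs).map (fun r => r.contents.body) = gs := by
  induction gs with
  | nil => rfl
  | cons g gs ih =>
    cases gs with
    | nil => rfl
    | cons g' gs => simp only [cutNodes, List.map_cons] at ih ⊢; rw [ih]

theorem fresh_cutNodes (key : α → WithTop K) (u : WithTop K) (gs : List (List (Stored α))) :
    ∀ r ∈ cutNodes key u gs, r.contents.buf = [] ∧ r.contents.size = 0 ∧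
      r.contents.emptied = false ∧ r.contents.body ∈ gs := by
  induction gs with
  | nil => simp [cutNodes]
  | cons g gs ih =>
    cases gs with
    | nil => simp [cutNodes]
    | cons g' gs =>
      intro r hr
      simp only [cutNodes, List.mem_cons] at hr
      rcases hr with rfl | hr
      · simp
      · obtain ⟨h1, h2, h3, h4⟩ := ih r (by simpa only [cutNodes] using hr)
        exact ⟨h1, h2, h3, List.mem_cons_of_mem _ h4⟩

theorem getLast?_cutNodes (key : α → WithTop K) (u : WithTop K) (gs : List (List (Stored α))) :
    ∀ r ∈ (cutNodes key u gs).getLast?, r.contents.upper = u := by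
  induction gs with
  | nil => simp [cutNodes]
  | cons g gs ih =>
    cases gs with
    | nil => simp [cutNodes]
    | cons g' gs =>
      intro r hr
      refine ih r ?_
      simp only [cutNodes, List.getLast?_cons] at hr
      rcases e : (cutNodes key u (g' :: gs)).getLast? with _ | d
      · have := body_cutNodes key u (g' :: gs)
        rw [List.getLast?_eq_none_iff.1 e] at this
        simp at this
      · rw [e] at hr; exact hr

theorem getLast?_flatten_cons {β : Type u} (g : List β) {gs : List (List β)}
    (h : gs.flatten ≠ []) : (g :: gs).flatten.getLast? = gs.flatten.getLast? := by
  rw [List.flatten_cons, List.getLast?_append_of_ne_nil _ h]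

variable [LinearOrder K]

/-- Entries are blocks for leaves and children for internal nodes; `rec` gives their records, so
both kinds of split share this argument. No group is empty, so the default `⊤` of `endKey` never
occurs. -/
theorem cutNodes_spec (key : α → WithTop K) (u : WithTop K) (rec : Stored α → List K)
    (gs : List (List (Stored α))) (hne : ∀ g ∈ gs, g ≠ [])
    (hsep : List.Pairwise (fun a b : Stored α => key a.contents < key b.contents ∧
      ∀ x ∈ rec b, key a.contents < (x : WithTop K)) gs.flatten)
    (hu : ∀ a ∈ gs.flatten, key a.contents ≤ u) :
    (∀ r ∈ cutNodes key u gs, ∀ a ∈ r.contents.body, key a.contents ≤ r.contents.upper) ∧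
    ((∀ a ∈ gs.flatten.getLast?, key a.contents = u) →
      ∀ r ∈ cutNodes key u gs, ∀ a ∈ r.contents.body.getLast?, key a.contents = r.contents.upper) ∧
    List.Pairwise (fun r s : Stored (Node K (List (Stored α))) =>
      r.contents.upper < s.contents.upper ∧
        ∀ a ∈ s.contents.body, ∀ x ∈ rec a, r.contents.upper < (x : WithTop K))
      (cutNodes key u gs) := by
  induction gs with
  | nil => simp [cutNodes]
  | cons g gs ih =>
    rw [List.flatten_cons] at hsep hu
    obtain ⟨s1, s2, s3⟩ := List.pairwise_append.1 hsep
    cases gs with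
    | nil =>
      simp only [cutNodes, List.mem_singleton, forall_eq, List.pairwise_singleton, and_true]
      exact ⟨fun a ha => hu a (by simp [ha]), fun h a ha => h a (by simpa using ha)⟩
    | cons g' gs =>
      obtain ⟨k1, k2, k3⟩ := ih (fun x hx => hne x (List.mem_cons_of_mem _ hx)) s2
        (fun a ha => hu a (List.mem_append_right _ ha))
      have hg := hne g (by simp)
      obtain ⟨init, z, rfl⟩ : ∃ init z, g = init ++ [z] :=
        ⟨_, _, (List.dropLast_append_getLast hg).symm⟩
      have hz : endKey key ⊤ (init ++ [z]) = key z.contents := by simp [endKey]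
      have hfl : (g' :: gs).flatten ≠ [] := by
        have := hne g' (by simp)
        simp [this]
      simp only [cutNodes, List.mem_cons, forall_eq_or_imp, hz, List.pairwise_cons]
      refine ⟨⟨?_, k1⟩, ?_, ⟨?_, k3⟩⟩
      · intro a ha
        rcases List.mem_append.1 ha with ha | ha
        · exact ((List.pairwise_append.1 s1).2.2 a ha z (by simp)).1.le
        · rw [List.mem_singleton.1 ha]
      · intro h
        rw [getLast?_flatten_cons _ hfl] at h
        refine ⟨?_, k2 h⟩
        intro a ha
        simp at ha
        rw [ha]
      · intro r hr
        have hb := (fresh_cutNodes key u _ r hr).2.2.2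
        have hmem : ∀ a ∈ r.contents.body, a ∈ (g' :: gs).flatten := fun a ha =>
          List.mem_flatten.2 ⟨_, hb, ha⟩
        have hzz : z ∈ init ++ [z] := by simp
        refine ⟨?_, fun a ha => (s3 z hzz a (hmem a ha)).2⟩
        obtain ⟨a, ha⟩ := List.exists_mem_of_ne_nil _ (hne _ (List.mem_cons_of_mem _ hb))
        exact (s3 z hzz a (hmem a ha)).1.trans_le (k1 r hr a ha)

end Splitting
-- Arithmetic of the number of parts
section Counting

theorem split_count {l m : ℕ} (hl : 0 < l) (hm : 0 < m) :
    1 ≤ (m + l - 1) / l ∧ m ≤ l * ((m + l - 1) / l) ∧ ((m + l - 1) / l - 1) * l + 1 ≤ m := by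
  have h1 := Nat.div_mul_le_self (m + l - 1) l
  have h2 := Nat.lt_mul_div_succ (m + l - 1) hl
  have h3 : 1 ≤ (m + l - 1) / l := (Nat.one_le_div_iff hl).2 (by omega)
  rw [Nat.mul_succ] at h2
  refine ⟨h3, by omega, ?_⟩
  obtain ⟨t, ht⟩ := Nat.exists_eq_add_of_le' h3
  rw [ht, Nat.succ_mul] at h1
  rw [ht, Nat.add_sub_cancel]
  omega

theorem split_count_le {l m e : ℕ} (hl : 0 < l) (hm : m ≤ l + e) : (m + l - 1) / l ≤ 1 + e := by
  rw [← Nat.lt_succ_iff, Nat.div_lt_iff_lt_mul hl]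
  have : e ≤ e * l := Nat.le_mul_of_pos_right e hl
  rw [Nat.succ_mul, add_mul]
  omega

/-- With `t ≥ 2` parts there are more than `(t - 1) * l ≥ t * l / 2` entries, so an even cut leaves
at least `⌊l / 2⌋` in each. -/
theorem half_mul_split_count {l m : ℕ} (hl : 0 < l) (hm : l ≤ m) :
    l / 2 * ((m + l - 1) / l) ≤ m := by
  obtain ⟨h1, -, h3⟩ := split_count hl (hl.trans_le hm)
  obtain ⟨t, ht⟩ := Nat.exists_eq_add_of_le' h1
  rw [ht, Nat.add_sub_cancel] at h3
  rw [ht]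
  have h4 : l / 2 * 2 ≤ l := Nat.div_mul_le_self _ _
  rcases t with _ | t
  · omega
  · have : l / 2 * 2 * (t + 1) ≤ (t + 1) * l := by
      rw [mul_comm (t + 1)]; exact Nat.mul_le_mul_right _ h4
    have h5 : l / 2 * (t + 1 + 1) + l / 2 * t = l / 2 * 2 * (t + 1) := by ring
    omega

theorem exists_append_of_mem_flatten {β : Type u} {gs : List (List β)} {g : List β} (h : g ∈ gs) :
    ∃ as bs, gs.flatten = as ++ (g ++ bs) := by
  obtain ⟨s, t, rfl⟩ := List.append_of_mem h
  exact ⟨s.flatten, t.flatten, by simp⟩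

theorem contentsOf_flatten {K : Type u} (gs : List (List (Block K))) :
    contentsOf gs.flatten = (gs.map contentsOf).flatten := by
  induction gs with
  | nil => rfl
  | cons g gs ih => simp [ih]

end Counting

/-! ### Splitting internal nodes and leaves -/

section Nodes

variable {K : Type u} [LinearOrder K]

/-- A list of nodes that may take the place of a node with bound `u`. -/
def Balanced (l B h : ℕ) (isRoot : Bool) (u : WithTop K) (rs : List (Stored (Tree K h))) : Prop :=
  rs ≠ [] ∧ ((∀ r ∈ rs, NodeOK l B h false r.contents) ∨
    (isRoot = true ∧ ∃ r, rs = [r] ∧ NodeOK l B h true r.contents)) ∧ Separated h rs ∧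
    ∀ r ∈ rs.getLast?, r.contents.upper = u

theorem NodeOK.balanced {l B h : ℕ} {isRoot : Bool} {c : Stored (Tree K h)}
    (hc : NodeOK l B h isRoot c.contents) : Balanced l B h isRoot c.contents.upper [c] := by
  refine ⟨by simp, ?_, List.pairwise_singleton _ _, by simp⟩
  cases isRoot with
  | false => exact Or.inl (by simpa using hc)
  | true => exact Or.inr ⟨rfl, c, rfl, hc⟩

theorem runs_splitNodes {P : Params} (hP : P.Valid) {h : ℕ} (isRoot : Bool) (u : WithTop K)
    (items : List (Stored (Tree K h))) (wt : ℕ → ℕ) (e : ℕ) (hm : 2 ≤ items.length)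
    (hm4 : isRoot = false → P.l ≤ 4 * items.length)
    (hok : ∀ c ∈ items, NodeOK P.l P.B h false c.contents) (hsep : Separated h items)
    (hlast : ∀ c ∈ items.getLast?, c.contents.upper = u) :
    ∃ rs : List (Stored (Tree K (h + 1))),
      Runs (split P Node.upper u items) rs items.length
        (items.length + (items.length + P.l - 1) / P.l) 0 1 ∧
      rs.length = (items.length + P.l - 1) / P.l ∧
      Balanced P.l P.B (h + 1) isRoot u rs ∧ (∀ r ∈ rs, r.contents.buf = []) ∧
      childRecords (h + 1) rs = childRecords h items ∧
      (rs.map fun r => credit wt e (h + 1) r.contents).sum =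
        (items.map fun c => credit wt e h c.contents).sum := by
  have hl := hP.le_l
  have hl0 : 0 < P.l := by omega
  obtain ⟨t1, t2, t3⟩ := split_count (m := items.length) hl0 (by omega)
  set t := (items.length + P.l - 1) / P.l with ht
  -- `a` is a lower bound for the degrees: all entries if there is no split, otherwise `⌊l / 2⌋`.
  -- Only an unsplit root can fall below `l / 4`.
  have hparts : ∃ a, 2 ≤ a ∧ (t = 1 ∨ P.l ≤ 4 * a) ∧ (isRoot = false → P.l ≤ 4 * a) ∧
      a * t ≤ items.length := by
    by_cases h1 : t = 1
    · exact ⟨items.length, hm, Or.inl h1, hm4, by rw [h1, mul_one]⟩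
    · refine ⟨P.l / 2, by omega, Or.inr (by omega), fun _ => by omega,
        half_mul_split_count hl0 ?_⟩
      have : 1 * P.l ≤ (t - 1) * P.l := Nat.mul_le_mul_right _ (by omega)
      omega
  obtain ⟨a, ha2, ha, ha4, hat⟩ := hparts
  obtain ⟨p1, p2, p3⟩ := parts_spec t items a P.l hat t2
  have hne : ∀ g ∈ parts t items, g ≠ [] := by
    rintro g hg rfl
    have := (p3 _ hg).1
    simp at this; omega
  have hu : ∀ c ∈ items, c.contents.upper ≤ u := by
    intro c hc
    obtain ⟨init, z, rfl⟩ : ∃ init z, items = init ++ [z] :=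
      ⟨_, _, (List.dropLast_append_getLast (List.ne_nil_of_mem hc)).symm⟩
    have hz : z.contents.upper = u := hlast z (by simp)
    rcases List.mem_append.1 hc with hc | hc
    · rw [← hz]
      exact ((List.pairwise_append.1 hsep).2.2 c hc z (by simp)).1.le
    · rw [List.mem_singleton.1 hc, hz]
  obtain ⟨c1, c2, c3⟩ := cutNodes_spec Node.upper u (fun c => recordsOf h c.contents)
    (parts t items) hne (by rw [p1]; exact hsep) (by rw [p1]; exact hu)
  rw [p1] at c2
  have c2 := c2 hlast
  have hfresh := fresh_cutNodes Node.upper u (parts t items)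
  have hbody := body_cutNodes Node.upper u (parts t items)
  have hrs : ∃ rs : List (Stored (Tree K (h + 1))), rs = cutNodes Node.upper u (parts t items) :=
    ⟨_, rfl⟩
  obtain ⟨rs, hrs⟩ := hrs
  rw [← hrs] at c1 c2 c3 hfresh hbody
  have hrec : ∀ r ∈ rs, recordsOf (h + 1) r.contents = childRecords h r.contents.body := by
    intro r hr
    rw [recordsOf_succ, (hfresh r hr).1]; rfl
  have hlen : rs.length = t := by
    rw [← p2, ← hbody, List.length_map]
  have hnode : ∀ b : Bool, (b = false → P.l ≤ 4 * a) → ∀ r ∈ rs,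
      NodeOK P.l P.B (h + 1) b r.contents := by
    intro b hb r hr
    obtain ⟨f1, f2, f3, f4⟩ := hfresh r hr
    obtain ⟨as, bs, hsplit⟩ := exists_append_of_mem_flatten f4
    rw [p1] at hsplit
    have hmem : ∀ c ∈ r.contents.body, c ∈ items := fun c hc => by
      rw [hsplit]; simp [hc]
    have hlB : 0 < P.l * P.B := Nat.mul_pos hl0 hP.one_le_B
    refine ⟨by rw [f1]; exact dense_nil _, by rw [f1, f2]; rfl, by rw [f2]; exact hlB, ?_, f3,
      (p3 _ f4).2, ha2.trans (p3 _ f4).1, ?_, fun c hc => hok c (hmem c hc), ?_, c2 r hr⟩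
    · intro x hx
      rw [hrec r hr] at hx
      obtain ⟨c, hc, hx⟩ := mem_childRecords.1 hx
      exact ((hok c (hmem c hc)).le_upper x hx).trans (c1 r hr c hc)
    · intro e
      exact (hb e).trans (Nat.mul_le_mul_left _ (p3 _ f4).1)
    · rw [Separated, hsplit] at hsep
      exact (List.pairwise_append.1 (List.pairwise_append.1 hsep).2.1).1
  refine ⟨rs, ?_, hlen, ⟨?_, ?_, ?_, ?_⟩, fun r hr => (hfresh r hr).1, ?_, ?_⟩
  · have := runs_makeNodes (K := K) Node.upper u (parts t items) (b := 1) le_rfl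
      (fun c _ => le_rfl)
    rw [p1, p2, ← hrs] at this
    exact this
  · rintro rfl
    simp at hlen; omega
  · cases isRoot with
    | false => exact Or.inl (hnode false ha4)
    | true =>
      rcases ha with ha | ha
      · rw [ha] at hlen
        obtain ⟨r, rfl⟩ := List.length_eq_one_iff.1 hlen
        exact Or.inr ⟨rfl, r, rfl, hnode true (by simp) r (by simp)⟩
      · exact Or.inl (hnode false fun _ => ha)
  · refine List.Pairwise.imp_of_mem ?_ c3
    intro r s hr hs hrs
    refine ⟨hrs.1, fun x hx => ?_⟩
    rw [hrec s hs] at hx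
    obtain ⟨c, hc, hx⟩ := mem_childRecords.1 hx
    exact hrs.2 c hc x hx
  · rw [hrs]; exact getLast?_cutNodes _ _ _
  · have : (rs.map fun r => recordsOf (h + 1) r.contents) =
        (rs.map fun r => r.contents.body).map (childRecords h) := by
      rw [List.map_map]; exact List.map_congr_left hrec
    rw [childRecords, this, hbody]
    conv_rhs => rw [← p1, childRecords, List.map_flatten, List.flatten_flatten, List.map_map]
    rfl
  · have : (rs.map fun r => credit wt e (h + 1) r.contents) =
        (rs.map fun r => r.contents.body).map
          fun g => (g.map fun c : Stored (Tree K h) => credit wt e h c.contents).sum := by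
      rw [List.map_map]
      refine List.map_congr_left fun r hr => ?_
      obtain ⟨f1, f2, f3, f4⟩ := hfresh r hr
      simp [credit, f1, f3]
    rw [this, hbody]
    conv_rhs => rw [← p1, List.map_flatten, List.sum_flatten, List.map_map]
    rfl

theorem exists_lastKey {xs : List K} (h : xs ≠ []) (hs : xs.Pairwise (· < ·)) :
    ∃ y ∈ xs, lastKey xs = (y : WithTop K) ∧ ∀ x ∈ xs, x ≤ y := by
  obtain ⟨init, z, rfl⟩ : ∃ init z, xs = init ++ [z] :=
    ⟨_, _, (List.dropLast_append_getLast h).symm⟩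
  refine ⟨z, by simp, by simp [lastKey]; rfl, fun x hx => ?_⟩
  rcases List.mem_append.1 hx with hx | hx
  · exact ((List.pairwise_append.1 hs).2.2 x hx z (by simp)).le
  · rw [List.mem_singleton.1 hx]

/-- Largest records of the blocks serve as keys, which turns a sorted file into input for
`cutNodes_spec`. -/
theorem pairwise_blocks {B : ℕ} {bs : List (Block K)} (hd : Dense B bs)
    (hs : (contentsOf bs).Pairwise (· < ·)) :
    (∀ b ∈ bs, b.contents ≠ [] ∧ b.contents.Pairwise (· < ·)) ∧
    List.Pairwise (fun a b : Block K => lastKey a.contents < lastKey b.contents ∧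
      ∀ x ∈ b.contents, lastKey a.contents < (x : WithTop K)) bs := by
  induction bs with
  | nil => simp
  | cons b bs ih =>
    rw [contentsOf_cons, List.pairwise_append] at hs
    obtain ⟨h1, h2, h3⟩ := dense_cons.1 hd
    obtain ⟨k1, k2⟩ := ih h3 hs.2.1
    have hb : b.contents ≠ [] := List.length_pos_iff.1 h1.1
    refine ⟨?_, List.pairwise_cons.2 ⟨?_, k2⟩⟩
    · intro c hc
      rcases List.mem_cons.1 hc with rfl | hc
      exacts [⟨hb, hs.1⟩, k1 c hc]
    · intro c hc
      obtain ⟨y, hy, e, hmax⟩ := exists_lastKey hb hs.1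
      have key : ∀ x ∈ c.contents, lastKey b.contents < (x : WithTop K) := by
        intro x hx
        rw [e]
        exact WithTop.coe_lt_coe.2 (hs.2.2 y hy x
          (List.mem_flatten.2 ⟨_, List.mem_map_of_mem hc, hx⟩))
      obtain ⟨z, hz, e', -⟩ := exists_lastKey (k1 c hc).1 (k1 c hc).2
      exact ⟨by rw [e']; exact key z hz, key⟩

theorem runs_splitLeaf {P : Params} (hP : P.Valid) (isRoot : Bool) (u : WithTop K)
    (items : List (Block K)) (wt : ℕ → ℕ) (e : ℕ)
    (hm : P.l * P.B ≤ (contentsOf items).length) (hd : Dense P.B items)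
    (hs : (contentsOf items).Pairwise (· < ·)) (hu : ∀ x ∈ contentsOf items, (x : WithTop K) ≤ u) :
    ∃ rs : List (Stored (Tree K 0)),
      Runs (split P lastKey u items) rs items.length
        (items.length + (items.length + P.l - 1) / P.l) 0 P.B ∧
      rs.length = (items.length + P.l - 1) / P.l ∧
      Balanced P.l P.B 0 isRoot u rs ∧ (∀ r ∈ rs, r.contents.buf = []) ∧
      childRecords 0 rs = contentsOf items ∧
      (rs.map fun r => credit wt e 0 r.contents).sum = 0 := by
  have hl := hP.le_l
  have hl0 : 0 < P.l := by omega
  have hB := hP.one_le_B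
  have hlm : P.l ≤ items.length := by
    have := hd.length_le
    exact Nat.le_of_mul_le_mul_right (hm.trans this) hB
  obtain ⟨t1, t2, t3⟩ := split_count (m := items.length) hl0 (by omega)
  have hat := half_mul_split_count hl0 hlm
  set t := (items.length + P.l - 1) / P.l with ht
  obtain ⟨p1, p2, p3⟩ := parts_spec t items (P.l / 2) P.l hat t2
  have hne : ∀ g ∈ parts t items, g ≠ [] := by
    rintro g hg rfl
    have := (p3 _ hg).1
    simp at this; omega
  obtain ⟨b1, b2⟩ := pairwise_blocks hd hs
  obtain ⟨c1, -, c3⟩ := cutNodes_spec lastKey u (fun c => c.contents)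
    (parts t items) hne (by rw [p1]; exact b2) (by
      rw [p1]
      intro b hb
      obtain ⟨y, hy, e, -⟩ := exists_lastKey (b1 b hb).1 (b1 b hb).2
      rw [e]
      exact hu y (List.mem_flatten.2 ⟨_, List.mem_map_of_mem hb, hy⟩))
  have hfresh := fresh_cutNodes lastKey u (parts t items)
  have hbody := body_cutNodes lastKey u (parts t items)
  obtain ⟨rs, hrs⟩ : ∃ rs : List (Stored (Tree K 0)), rs = cutNodes lastKey u (parts t items) :=
    ⟨_, rfl⟩
  rw [← hrs] at c1 c3 hfresh hbody
  have hrec : ∀ r ∈ rs, recordsOf 0 r.contents = contentsOf r.contents.body := by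
    intro r hr
    rw [recordsOf_zero, (hfresh r hr).1]; rfl
  have hlen : rs.length = t := by
    rw [← p2, ← hbody, List.length_map]
  refine ⟨rs, ?_, hlen, ⟨?_, ?_, ?_, ?_⟩, fun r hr => (hfresh r hr).1, ?_, ?_⟩
  · have := runs_makeNodes (K := K) lastKey u (parts t items) (b := P.B) hB
      (fun c hc => by rw [p1] at hc; exact (hd.1 c hc).2)
    rw [p1, p2, ← hrs] at this
    exact this
  · rintro rfl
    simp at hlen; omega
  · refine Or.inl fun r hr => ?_
    obtain ⟨f1, f2, f3, f4⟩ := hfresh r hr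
    obtain ⟨as, bs, hsplit⟩ := exists_append_of_mem_flatten f4
    rw [p1] at hsplit
    have hmem : ∀ c ∈ r.contents.body, c ∈ items := fun c hc => by
      rw [hsplit]; simp [hc]
    have hlB : 0 < P.l * P.B := Nat.mul_pos hl0 hP.one_le_B
    have hdb : Dense P.B r.contents.body := by
      rw [hsplit] at hd
      exact hd.of_append_right.of_append_left
    have hp := p3 _ f4
    refine ⟨by rw [f1]; exact dense_nil _, by rw [f1, f2]; rfl, by rw [f2]; exact hlB, ?_,
      hdb, ?_, hp.2, ?_, ?_⟩
    · intro x hx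
      rw [hrec r hr] at hx
      obtain ⟨_, hcs, hx⟩ := List.mem_flatten.1 hx
      obtain ⟨c, hc, rfl⟩ := List.mem_map.1 hcs
      obtain ⟨y, hy, e, hmax⟩ := exists_lastKey (b1 c (hmem c hc)).1 (b1 c (hmem c hc)).2
      have := c1 r hr c hc
      rw [e] at this
      exact (WithTop.coe_le_coe.2 (hmax x hx)).trans this
    · rw [hsplit, contentsOf_append, contentsOf_append] at hs
      exact (List.pairwise_append.1 (List.pairwise_append.1 hs).2.1).1
    · exact hdb.length_le.trans (Nat.mul_le_mul_right _ hp.2)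
    · intro _
      -- At least `⌊l / 2⌋` blocks, one of them possibly partial, hold more than `(⌊l / 2⌋ - 1)B`
      -- records; this is at least `lB / 4` because `l ≥ 8`.
      have h1 := hdb.length_mul_lt (hne _ f4)
      have h2 : P.l / 2 * P.B ≤ List.length r.contents.body * P.B := Nat.mul_le_mul_right _ hp.1
      have h3 : P.l * P.B ≤ (4 * (P.l / 2) - 4) * P.B := Nat.mul_le_mul_right _ (by omega)
      rw [Nat.sub_mul, mul_assoc] at h3
      omega
  · refine List.Pairwise.imp_of_mem ?_ c3
    intro r s hr hs hrs
    refine ⟨hrs.1, fun x hx => ?_⟩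
    rw [hrec s hs] at hx
    obtain ⟨_, hcs, hx⟩ := List.mem_flatten.1 hx
    obtain ⟨c, hc, rfl⟩ := List.mem_map.1 hcs
    exact hrs.2 c hc x hx
  · rw [hrs]; exact getLast?_cutNodes _ _ _
  · have : (rs.map fun r => recordsOf 0 r.contents) =
        (rs.map fun r => r.contents.body).map contentsOf := by
      rw [List.map_map]; exact List.map_congr_left hrec
    rw [childRecords, this, hbody, ← contentsOf_flatten, p1]
  · rw [List.sum_eq_zero_iff]
    intro n hn
    obtain ⟨r, hr, rfl⟩ := List.mem_map.1 hn
    simp [credit, (hfresh r hr).1]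

end Nodes
-- Second phase: emptying full leaves and splitting upwards
section SecondPhase

/-- Here `n` is the number of additional nodes; the `d` units saved for each of them are kept in the
sum for use by the parent. -/
theorem sum_flatten_add_le {α β : Type u} {g : α → List β} {w f : α → ℕ} {f' : β → ℕ} {B d : ℕ}
    (as : List α) (hne : ∀ a ∈ as, g a ≠ [])
    (h : ∀ a ∈ as, B * w a + ((g a).map f').sum + d * ((g a).length - 1) ≤ f a + B) :
    ∃ n, (as.map g).flatten.length = as.length + n ∧
      B * (as.map w).sum + ((as.map g).flatten.map f').sum + d * n ≤
        (as.map f).sum + as.length * B := by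
  induction as with
  | nil => exact ⟨0, by simp⟩
  | cons a as ih =>
    obtain ⟨n, h1, h2⟩ := ih (fun b hb => hne b (by simp [hb])) fun b hb => h b (by simp [hb])
    have h3 := h a (by simp)
    have h4 : 0 < (g a).length := List.length_pos_iff.2 (hne a (by simp))
    refine ⟨n + ((g a).length - 1), ?_, ?_⟩
    · simp only [List.map_cons, List.flatten_cons, List.length_append, h1, List.length_cons]
      omega
    · simp only [List.map_cons, List.flatten_cons, List.map_append, List.sum_append, List.sum_cons,
        List.length_cons, mul_add, Nat.succ_mul]
      omega

variable {K : Type u}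

theorem childRecords_flatten_perm {h : ℕ} {cs : List (Stored (Tree K h))}
    {g : Stored (Tree K h) → List (Stored (Tree K h))}
    (hr : ∀ c ∈ cs, (childRecords h (g c)).Perm (recordsOf h c.contents)) :
    (childRecords h (cs.map g).flatten).Perm (childRecords h cs) := by
  induction cs with
  | nil => simp
  | cons c cs ih =>
    simp only [List.map_cons, childRecords_cons, List.flatten_cons, childRecords_append]
    exact (hr c (by simp)).append (ih fun d hd => hr d (by simp [hd]))

variable [LinearOrder K]

theorem NodeOK.exists_mem {l B h : ℕ} (hlB : 0 < l * B) {v : Tree K h}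
    (hv : NodeOK l B h false v) : ∃ x, x ∈ recordsOf h v := by
  induction h with
  | zero =>
    have h1 := hv.2.2.2.2.2.2.2.2 rfl
    rcases e : contentsOf v.body with _ | ⟨x, xs⟩
    · rw [e, List.length_nil] at h1; omega
    · exact ⟨x, by rw [recordsOf_zero, e]; simp⟩
  | succ h ih =>
    obtain ⟨-, -, -, -, -, -, h2, -, h3, -⟩ := hv
    obtain ⟨c, hc⟩ := List.exists_mem_of_length_pos (l := (v.body : List (Stored (Tree K h))))
      (by omega)
    obtain ⟨x, hx⟩ := ih (h3 c hc)
    exact ⟨x, by rw [recordsOf_succ]; exact List.mem_append_right _ (mem_childRecords.2 ⟨c, hc, hx⟩)⟩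

/-- Strictness between the bounds of pieces of different nodes comes from a record: a piece that is
not a root is nonempty, and its record lies above all earlier bounds and below its own. -/
theorem Separated.flatten {l B h : ℕ} (hlB : 0 < l * B) {cs : List (Stored (Tree K h))}
    {g : Stored (Tree K h) → List (Stored (Tree K h))} (hs : Separated h cs)
    (hb : ∀ c ∈ cs, Balanced l B h false c.contents.upper (g c))
    (hr : ∀ c ∈ cs, ∀ x ∈ childRecords h (g c), x ∈ recordsOf h c.contents) :
    Separated h (cs.map g).flatten ∧
      (∀ r ∈ (cs.map g).flatten, NodeOK l B h false r.contents) ∧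
      ∀ u, (∀ c ∈ cs.getLast?, c.contents.upper = u) →
        ∀ r ∈ (cs.map g).flatten.getLast?, r.contents.upper = u := by
  have hok : ∀ c ∈ cs, ∀ r ∈ g c, NodeOK l B h false r.contents := fun c hc => by
    rcases (hb c hc).2.1 with h | ⟨h, -⟩
    · exact h
    · simp at h
  refine ⟨?_, ?_, ?_⟩
  · rw [Separated, List.pairwise_flatten]
    constructor
    · intro rs hrs
      obtain ⟨c, hc, rfl⟩ := List.mem_map.1 hrs
      exact (hb c hc).2.2.1
    · rw [List.pairwise_map]
      refine List.Pairwise.imp_of_mem ?_ hs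
      intro c d hc hd hcd r hr' s hs'
      have h1 : r.contents.upper ≤ c.contents.upper := by
        obtain ⟨h1, -, h2, h3⟩ := hb c hc
        obtain ⟨init, z, e⟩ : ∃ init z, g c = init ++ [z] :=
          ⟨_, _, (List.dropLast_append_getLast h1).symm⟩
        rw [e] at hr' h2 h3
        have hz : z.contents.upper = c.contents.upper := h3 z (by simp)
        rcases List.mem_append.1 hr' with hr' | hr'
        · rw [← hz]
          exact ((List.pairwise_append.1 h2).2.2 r hr' z (by simp)).1.le
        · rw [List.mem_singleton.1 hr', hz]
      have h2 : ∀ x ∈ recordsOf h s.contents, r.contents.upper < (x : WithTop K) := fun x hx =>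
        h1.trans_lt (hcd.2 x (hr d hd x (mem_childRecords.2 ⟨s, hs', hx⟩)))
      obtain ⟨x, hx⟩ := (hok d hd s hs').exists_mem hlB
      exact ⟨(h2 x hx).trans_le ((hok d hd s hs').le_upper x hx), h2⟩
  · intro r hr
    obtain ⟨_, h1, h2⟩ := List.mem_flatten.1 hr
    obtain ⟨c, hc, rfl⟩ := List.mem_map.1 h1
    exact hok c hc r h2
  · intro u hu r hr
    rcases cs.eq_nil_or_concat with rfl | ⟨init, z, rfl⟩
    · simp at hr
    · have hz := hb z (by simp)
      rw [List.concat_eq_append, List.map_append, List.flatten_append, List.map_singleton,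
        List.flatten_singleton, List.getLast?_append_of_ne_nil _ hz.1] at hr
      rw [hz.2.2.2 r hr]
      exact hu z (by simp)

/-- Of the units of each buffered record, 11 pay for sorting, two merges and the split; the
remaining `d` endow every additional leaf with `4Bd` units. -/
theorem runs_rebalance_leaf {P : Params} (hP : P.Valid) {wt : ℕ → ℕ} {d : ℕ} (hwt : 11 + d ≤ wt 0)
    (isRoot : Bool) (c : Stored (Tree K 0)) (hc : Drained P.l P.B 0 isRoot c.contents)
    (hnd : (recordsOf 0 c.contents).Nodup) :
    ∃ rs w, Runs (rebalance P 0 c) rs (P.k * w) w 0 (P.M + 6 * P.B) ∧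
      Balanced P.l P.B 0 isRoot c.contents.upper rs ∧
      (∀ r ∈ rs, r.contents.buf = [] ∨ r.contents.buf = c.contents.buf) ∧
      (childRecords 0 rs).Perm (recordsOf 0 c.contents) ∧
      P.B * w + (rs.map fun r => credit wt (3 * (P.l * P.B)) 0 r.contents).sum +
        4 * P.B * d * (rs.length - 1) ≤ credit wt (3 * (P.l * P.B)) 0 c.contents + P.B := by
  have hB := hP.one_le_B
  have hk := hP.one_le_k
  by_cases hfull : c.contents.size < P.l * P.B
  · refine ⟨[c], 1, ?_, (nodeOK_iff.2 ⟨hc, hfull⟩).balanced, by simp, by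
      rw [childRecords_cons, childRecords_nil, List.append_nil], ?_⟩
    swap
    · simp only [List.map_cons, List.map_nil, List.sum_cons, List.sum_nil, List.length_singleton,
        Nat.sub_self]
      omega
    simp only [rebalance]
    refine Runs.mono (Runs.bind (runs_loadNode c)
      (r2 := 0) (w2 := 0) (d2 := -1) (pk2 := 0) ?_) ?_ ?_ ?_ ?_
    · rw [if_pos hfull]
      exact Runs.mono (Runs.bind (runs_release 1) (Runs.pure _)) le_rfl le_rfl rfl (by omega)
    all_goals omega
  · obtain ⟨hbuf, hle, hbd, hbs, hbl, hbl', -⟩ := hc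
    generalize hv : c.contents = v at *
    rw [recordsOf_zero] at hnd
    obtain ⟨s, k1, k2, k3, k4, k5, k6⟩ :=
      runs_sortBuffer hP v hbuf (by omega) hnd.of_append_left
    have k7 := k5.length_eq
    rw [List.length_append, ← hbuf.2.1] at k7
    obtain ⟨o, m1, m2, m3⟩ := runs_mergeFiles P hB v.size s (v.buf.drop P.l) k2 k3 (by omega)
    have m4 : (contentsOf o).Perm (contentsOf v.buf) := by
      rw [m3]; exact (List.merge_perm_append _).trans k5
    have m5 : (contentsOf o).length = v.size := by rw [m4.length_eq, hbuf.2.1]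
    obtain ⟨out, n1, n2, n3⟩ := runs_mergeFiles P hB (v.size + P.l * P.B) o v.body m2 hbd (by omega)
    have n4 : (contentsOf out).Perm (recordsOf 0 v) := by
      rw [n3, recordsOf_zero]; exact (List.merge_perm_append _).trans (m4.append_right _)
    have n5 : (contentsOf out).length = v.size + (contentsOf v.body).length := by
      rw [n4.length_eq, recordsOf_zero, List.length_append, hbuf.2.1]
    have n6 : (contentsOf out).Pairwise (· < ·) := by
      rw [n3]
      refine pairwise_lt_merge ?_ (hbs.imp le_of_lt) ?_
      · rw [m3]; exact k6.imp le_of_lt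
      · exact (m4.append_right _).nodup_iff.2 hnd
    obtain ⟨rs, s1, s2, s3, s6, s4, s5⟩ := runs_splitLeaf hP isRoot v.upper out wt (3 * (P.l * P.B))
      (by omega) n2 n6 (fun x hx => hle x (n4.mem_iff.1 hx))
    have hl := hP.le_l
    have hlB := hP.B_le
    have hlm : P.l ≤ out.length := by
      have := n2.length_le
      exact Nat.le_of_mul_le_mul_right (le_trans (by omega) this) hB
    obtain ⟨t1, t2, t3⟩ := split_count (l := P.l) (m := out.length) (by omega) (by omega)
    set t := (out.length + P.l - 1) / P.l with ht
    have t4 : t ≤ out.length := by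
      have : (t - 1) * 1 ≤ (t - 1) * P.l := Nat.mul_le_mul_left _ (by omega)
      omega
    refine ⟨rs, P.l + (1 + v.buf.length + o.length + List.length v.body + 2 * out.length + t), ?_,
      s3, fun r hr => Or.inl (s6 r hr), ?_, ?_⟩
    · simp only [rebalance]
      refine Runs.mono (Runs.bind (runs_loadNode c)
        (r2 := P.k * P.l + (v.buf.length + o.length + List.length v.body + out.length))
        (w2 := P.l + (o.length + 2 * out.length + t))
        (d2 := -1) (pk2 := P.M + 6 * P.B - 1) ?_) ?_ ?_ ?_ ?_
      · rw [hv, if_neg hfull]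
        refine Runs.mono (Runs.bind k1 (Runs.bind m1 (Runs.bind n1 (Runs.bind (runs_release 1)
          s1)))) ?_ ?_ ?_ ?_
        all_goals omega
      · rw [mul_add]
        have := Nat.le_mul_of_pos_left
          (1 + v.buf.length + o.length + List.length v.body + 2 * out.length + t) hk
        omega
      all_goals omega
    · rw [s4]; exact n4
    -- With at most `lB` records already in the leaf, the transfers cost at most `5 size + 5lB +
    -- 6B`, which is at most `11 size + B` as `8B ≤ lB ≤ size`.
    · rw [s5, s2]
      have c1 := hbuf.1.length_mul_le
      have c2 := m2.length_mul_le
      have c3 := n2.length_mul_le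
      rw [← hbuf.2.1] at c1
      rw [m5] at c2
      rw [n5] at c3
      have c4 : List.length v.body * P.B ≤ P.l * P.B := Nat.mul_le_mul_right _ hbl
      have c5 : t * P.B ≤ out.length * P.B := Nat.mul_le_mul_right _ t4
      -- `t` leaves require more than `(t - 1) * l` blocks, so `(t - 1) * lB ≤ size + lB ≤ 2 size`,
      -- and `l ≥ 8`.
      have c6 : 4 * P.B * (t - 1) ≤ v.size := by
        have e1 : ((t - 1) * P.l + 1) * P.B ≤ out.length * P.B := Nat.mul_le_mul_right _ t3
        have e2 : (t - 1) * 8 * P.B ≤ (t - 1) * P.l * P.B :=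
          Nat.mul_le_mul_right _ (Nat.mul_le_mul_left _ hl)
        have e3 : 4 * P.B * (t - 1) * 2 = (t - 1) * 8 * P.B := by ring
        rw [Nat.succ_mul] at e1
        omega
      have c7 : 4 * P.B * d * (t - 1) ≤ d * v.size := by
        calc 4 * P.B * d * (t - 1) = d * (4 * P.B * (t - 1)) := by ring
          _ ≤ _ := Nat.mul_le_mul_left _ c6
      have c8 := Nat.mul_le_mul_right v.size hwt
      rw [add_mul] at c8
      simp only [credit, ← hbuf.2.1]
      have c9 : P.B * (P.l + (1 + v.buf.length + o.length + List.length v.body + 2 * out.length + t))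
        = P.l * P.B + P.B + v.buf.length * P.B + o.length * P.B + List.length v.body * P.B +
          2 * (out.length * P.B) + t * P.B := by ring
      rw [c9]
      omega

/-- Every additional node at height `h` keeps `4B` units for each of the `j = H - h` levels above,
and `4B` more for a growth of the root. A parent spends one such share on each additional child and
passes on the others. -/
theorem runs_rebalance {P : Params} (hP : P.Valid) {wt : ℕ → ℕ} {H : ℕ} (hwt : 12 + H ≤ wt 0)
    (h j : ℕ) (hH : h + j = H) (isRoot : Bool) (c : Stored (Tree K h))
    (hc : Drained P.l P.B h isRoot c.contents) (hnd : (recordsOf h c.contents).Nodup) :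
    ∃ rs w, Runs (rebalance P h c) rs (P.k * w) w 0 (P.M + 6 * P.B) ∧
      Balanced P.l P.B h isRoot c.contents.upper rs ∧
      (∀ r ∈ rs, r.contents.buf = [] ∨ r.contents.buf = c.contents.buf) ∧
      (childRecords h rs).Perm (recordsOf h c.contents) ∧
      P.B * w + (rs.map fun r => credit wt (3 * (P.l * P.B)) h r.contents).sum +
        4 * P.B * (j + 1) * (rs.length - 1) ≤ credit wt (3 * (P.l * P.B)) h c.contents + P.B := by
  have hB := hP.one_le_B
  have hk := hP.one_le_k
  induction h generalizing j isRoot with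
  | zero => exact runs_rebalance_leaf hP (by omega) isRoot c hc hnd
  | succ h ih =>
    rcases hc with hc | ⟨hem, hbuf, ⟨hle, hlen, hlen2, hlen4, hsep, hlast⟩, hch⟩
    · refine ⟨[c], 1, ?_, hc.balanced, by simp, by
      rw [childRecords_cons, childRecords_nil, List.append_nil], ?_⟩
      have hem : c.contents.emptied = false := hc.2.2.2.2.1
      swap
      · simp only [List.map_cons, List.map_nil, List.sum_cons, List.sum_nil, List.length_singleton,
          Nat.sub_self]
        omega
      simp only [rebalance]
      refine Runs.mono (Runs.bind (runs_loadNode c)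
        (r2 := 0) (w2 := 0) (d2 := -1) (pk2 := 0) ?_) ?_ ?_ ?_ ?_
      · rw [hem]
        exact Runs.mono (Runs.bind (runs_release 1) (Runs.pure _)) le_rfl le_rfl rfl (by omega)
      all_goals omega
    · generalize hv : c.contents = v at *
      rw [recordsOf_succ, hbuf, contentsOf_nil, List.nil_append] at hnd
      obtain ⟨g, w, f1, f2⟩ := exists_runs_forEach (f := rebalance P h) (k := P.k)
        (pk := P.M + 6 * P.B) (by omega) (v.body : List (Stored (Tree K h)))
        (fun c hc => ih (j + 1) (by omega) false c (hch c hc) (nodup_of_mem_childRecords hnd hc))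
      have hperm := childRecords_flatten_perm fun c hc => (f2 c hc).2.2.1
      have hlB : 0 < P.l * P.B := Nat.mul_pos (by have := hP.le_l; omega) hB
      obtain ⟨g1, g2, g3⟩ := hsep.flatten hlB (fun c hc => (f2 c hc).1)
        fun c hc x hx => (f2 c hc).2.2.1.mem_iff.1 hx
      obtain ⟨n, e1, e2⟩ := sum_flatten_add_le
        (f := fun c : Stored (Tree K h) => credit wt (3 * (P.l * P.B)) h c.contents)
        (f' := fun c : Stored (Tree K h) => credit wt (3 * (P.l * P.B)) h c.contents)
        (v.body : List (Stored (Tree K h)))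
        (fun c hc => (f2 c hc).1.1) fun c hc => (f2 c hc).2.2.2
      set items := (List.map g (v.body : List (Stored (Tree K h)))).flatten with hitems
      obtain ⟨rs, s1, s2, s3, s6, s4, s5⟩ := runs_splitNodes hP isRoot v.upper items wt
        (3 * (P.l * P.B)) (by omega) (fun e => by have := hlen4 e; omega) g2 g1 (g3 _ hlast)
      have t1 := split_count_le (l := P.l) (m := items.length) (e := n)
        (by have := hP.le_l; omega) (by omega)
      set t := (items.length + P.l - 1) / P.l with ht
      refine ⟨rs, (List.map w (v.body : List (Stored (Tree K h)))).sum + (2 + items.length + t), ?_,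
        s3, fun r hr => Or.inl (s6 r hr), ?_, ?_⟩
      · simp only [rebalance]
        refine Runs.mono (Runs.bind (runs_loadNode c)
          (r2 := P.k * (List.map w (v.body : List (Stored (Tree K h)))).sum + 1 + items.length)
          (w2 := (List.map w (v.body : List (Stored (Tree K h)))).sum + 1 + items.length + t)
          (d2 := -1) (pk2 := P.M + 6 * P.B - 1) ?_) ?_ ?_ ?_ ?_
        · rw [hv, hem]
          refine Runs.mono (Runs.bind runs_save (Runs.bind f1 (Runs.bind runs_restore
            (Runs.bind (runs_release 1) s1)))) ?_ ?_ ?_ ?_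
          all_goals omega
        · rw [mul_add]
          have := Nat.le_mul_of_pos_left (2 + items.length + t) hk
          omega
        all_goals omega
      · rw [s4, recordsOf_succ, hbuf]
        exact hperm
      -- The mark of `3lB` pays for the header and work list, copying the old children, one new
      -- header and the spare `B` of each old child. The `n` additional children cost at most `2nB`
      -- more (their copies and at most `n` further headers), out of their `4nB`; the node itself
      -- splits into at most `1 + n` pieces.
      · rw [s5, s2]
        simp only [credit, hem, hbuf, contentsOf_nil, List.length_nil, if_true]
        have c1 : List.length (v.body : List (Stored (Tree K h))) * P.B ≤ P.l * P.B :=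
          Nat.mul_le_mul_right _ hlen
        have c2 := hP.B_le
        have c3 : (t - 1) * (4 * P.B * (j + 1)) ≤ n * (4 * P.B * (j + 1)) :=
          Nat.mul_le_mul_right _ (by omega)
        have c4 : t * P.B ≤ P.B + n * P.B := by
          calc t * P.B ≤ (1 + n) * P.B := Nat.mul_le_mul_right _ t1
            _ = _ := by ring
        have c5 : 4 * P.B * (j + 1 + 1) * n = n * (4 * P.B * (j + 1)) + 4 * (n * P.B) := by ring
        have c6 : P.B * ((List.map w (v.body : List (Stored (Tree K h)))).sum +
            (2 + items.length + t)) =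
          P.B * (List.map w (v.body : List (Stored (Tree K h)))).sum + 2 * P.B +
            items.length * P.B + t * P.B := by ring
        have c7 : items.length * P.B =
            List.length (v.body : List (Stored (Tree K h))) * P.B + n * P.B := by
          rw [e1, add_mul]
        rw [c5] at e2
        rw [c6, c7, mul_comm (4 * P.B * (j + 1))]
        omega

end SecondPhase
-- Growing the root, and one insertion after another
section Insertion

variable {K : Type u} [LinearOrder K]

/-- Each round reduces `rs.length - 1` at least by the factor 8, so the transfers form a geometric
sum. -/
theorem runs_grow {P : Params} (hP : P.Valid) (wt : ℕ → ℕ) (e : ℕ) (n h : ℕ)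
    (rs : List (Stored (Tree K h))) (hn : rs.length ≤ n) (hb : Balanced P.l P.B h true ⊤ rs)
    (hbuf : ∀ r ∈ rs, ∀ b ∈ r.contents.buf, b.contents.length = P.B) :
    ∃ (T : BufferTree K) (w : ℕ), Runs (grow P n h rs) T w w 0 1 ∧ IsBufferTree P.l P.B T ∧
      T.tail = [] ∧ h ≤ T.height ∧
      recordsOf T.height T.root.contents = childRecords h rs ∧
      credit wt e T.height T.root.contents = (rs.map fun r => credit wt e h r.contents).sum ∧
      w ≤ 4 * (rs.length - 1) := by
  have hB := hP.one_le_B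
  induction n generalizing h rs with
  | zero => exact absurd (List.length_eq_zero_iff.1 (by omega)) hb.1
  | succ n ih =>
    obtain ⟨hne, hok, hsep, hlast⟩ := hb
    rcases rs with _ | ⟨r, _ | ⟨r', rs⟩⟩
    · simp at hne
    · have hr : NodeOK P.l P.B h true r.contents := by
        rcases hok with hok | ⟨-, s, hs, hok⟩
        · have := hok r (by simp)
          rw [nodeOK_iff] at this ⊢
          refine ⟨?_, this.2⟩
          cases h with
          | zero =>
            obtain ⟨h1, h2, h3, h4, h5, h6, -⟩ := this.1
            exact ⟨h1, h2, h3, h4, h5, h6, by simp⟩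
          | succ h =>
            obtain ⟨h1, h2, ⟨h3, h4, h5, -, h6⟩, h7⟩ := this.1
            exact ⟨h1, h2, ⟨h3, h4, h5, by simp, h6⟩, h7⟩
        · simp at hs; rw [hs]; exact hok
      refine ⟨⟨[], h, r⟩, 0, ?_, ⟨hr, hlast r (by simp), hbuf r (by simp), hB⟩, rfl,
        le_rfl, by rw [childRecords_cons, childRecords_nil, List.append_nil], by simp, by simp⟩
      simp only [grow]
      exact (Runs.pure _).mono le_rfl le_rfl rfl (by omega)
    · obtain ⟨l, hl⟩ : ∃ l, l = r :: r' :: rs := ⟨_, rfl⟩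
      have hg : grow P (n + 1) h (r :: r' :: rs) =
          (do let rs' ← split P Node.upper ⊤ l; grow P n (h + 1) rs') := by rw [hl]; rfl
      rw [hg]
      have hlen : 2 ≤ l.length := by rw [hl]; simp
      rw [← hl] at hn hsep hlast hok hbuf ⊢
      have hok' : ∀ r ∈ l, NodeOK P.l P.B h false r.contents := by
        rcases hok with hok | ⟨-, s, hs, -⟩
        · exact hok
        · rw [hs] at hlen; simp at hlen
      obtain ⟨rs', s1, s2, s3, s4, s5, s6⟩ := runs_splitNodes hP true ⊤ l wt e hlen (by simp)
        hok' hsep hlast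
      have hl8 := hP.le_l
      obtain ⟨t1, -, t3⟩ := split_count (l := P.l) (m := l.length) (by omega) (by omega)
      rw [← s2] at t1 t3 s1
      have t4 : (rs'.length - 1) * 8 ≤ (rs'.length - 1) * P.l := Nat.mul_le_mul_left _ hl8
      obtain ⟨T, w, k1, k2, k3, k4, k5, k6, k7⟩ := ih (h + 1) rs' (by omega) s3
        (fun r hr b hb => by rw [s4 r hr] at hb; simp at hb)
      refine ⟨T, (l.length + rs'.length) + w, ?_, k2, k3, by omega, by rw [k5, s5],
        by rw [k6, s6], by omega⟩
      refine Runs.mono (Runs.bind s1 k1) ?_ ?_ ?_ ?_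
      all_goals omega

/-- The credit of a record in a buffer at height `h` of a tree of height at most `H`. -/
def weight (H h : ℕ) : ℕ := 13 * h + (12 + H)

/-- The credit of a buffer tree; `14 H + 16` is that of a record in the tail. -/
def BufferTree.credit (P : Params) (H : ℕ) (T : BufferTree K) : ℕ :=
  AEM.credit (weight H) (3 * (P.l * P.B)) T.height T.root.contents + (14 * H + 16) * T.tail.length

/-- The occupancy before the call is the tail; subtracting its length makes `M + 6B` an absolute
bound, so peaks do not add up over successive insertions. -/
theorem runs_insert {P : Params} (hP : P.Valid) (x : K) (T : BufferTree K)
    (hT : IsBufferTree P.l P.B T) (hnd : (T.records ++ [x]).Nodup) (H : ℕ) (hH : T.height ≤ H) :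
    ∃ (T' : BufferTree K) (w : ℕ),
      Runs (insert P x T) T' (P.k * w) w ((T'.tail.length : ℤ) - T.tail.length)
        (P.M + 6 * P.B - T.tail.length) ∧
      IsBufferTree P.l P.B T' ∧ T'.records.Perm (T.records ++ [x]) ∧ T.height ≤ T'.height ∧
      P.B * w + T'.credit P H ≤ T.credit P H + (14 * H + 16) := by
  have hB := hP.one_le_B
  have hk := hP.one_le_k
  obtain ⟨tail, h, ⟨v⟩⟩ := T
  obtain ⟨hv, hu, hfull, htail⟩ := hT
  dsimp only at hv hu hfull htail hH
  simp only [BufferTree.records] at hnd ⊢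
  by_cases hlt : (tail ++ [x]).length < P.B
  · refine ⟨⟨tail ++ [x], h, ⟨v⟩⟩, 0, ?_, ⟨hv, hu, hfull, hlt⟩, ?_, le_rfl, ?_⟩
    · simp only [insert, if_pos hlt]
      rw [List.length_append, List.length_singleton] at hlt
      refine Runs.mono (Runs.bind (runs_occupy 1) (Runs.pure _)) ?_ ?_ ?_ ?_
      all_goals try simp only [List.length_append, List.length_singleton]
      all_goals omega
    · simp only [List.append_assoc]
      exact List.Perm.append_left _ List.perm_append_comm
    · simp only [BufferTree.credit, List.length_append, List.length_singleton, mul_add, mul_one]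
      omega
  · have hys : (tail ++ [x]).length = P.B := by
      rw [List.length_append, List.length_singleton] at hlt ⊢; omega
    have htl : tail.length + 1 = P.B := by simpa using hys
    have hbo := hv.bufferOK
    have hsize := (nodeOK_iff.1 hv).2
    have hvs : v.size = v.buf.length * P.B := by rw [hbo.2.1, length_contentsOf hfull]
    have hsB : v.size + P.B ≤ P.l * P.B := by
      rw [hvs] at hsize ⊢
      rw [← Nat.succ_mul]
      exact Nat.mul_le_mul_right _ (Nat.lt_of_mul_lt_mul_right hsize)
    obtain ⟨v', hv'⟩ : ∃ v' : Tree K h,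
      v' = { v with buf := v.buf ++ [⟨tail ++ [x]⟩], size := v.size + P.B } := ⟨_, rfl⟩
    have hbuf' : contentsOf (v.buf ++ [⟨tail ++ [x]⟩]) = contentsOf v.buf ++ (tail ++ [x]) := by simp
    have hfull' : ∀ b ∈ v.buf ++ [⟨tail ++ [x]⟩], b.contents.length = P.B := by
      intro b hb
      rcases List.mem_append.1 hb with hb | hb
      · exact hfull b hb
      · rw [List.mem_singleton.1 hb]; exact hys
    have hrecv : Receiving P.l P.B h true v' := by
      rw [hv']
      have := hv.append_buf (buf := v.buf ++ [⟨tail ++ [x]⟩]) (Y := tail ++ [x])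
        (by rw [← List.append_nil (v.buf ++ _)]; exact Dense.append hfull' hB (dense_nil _)) hbuf'
        (by
          rw [List.drop_eq_nil_of_le (by rw [List.length_append, ← hbo.2.1, hys]; exact hsB)]
          exact List.Pairwise.nil)
        (by rw [hu]; simp)
      rwa [hys] at this
    have hperm : (recordsOf h v').Perm (tail ++ recordsOf h v ++ [x]) := by
      rw [hv']
      refine (recordsOf_append_buf v hbuf').trans ?_
      rw [← List.append_assoc]
      exact List.Perm.append_right _ List.perm_append_comm
    have hnd' : (recordsOf h v').Nodup := hperm.nodup_iff.2 hnd
    have hcredit : credit (weight H) (3 * (P.l * P.B)) h v' =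
        credit (weight H) (3 * (P.l * P.B)) h v + weight H h * P.B := by
      rw [hv', credit_append_buf v hbuf', hys]
    have hu' : v'.upper = ⊤ := by rw [hv']; exact hu
    -- When the tail becomes a block, its `B` records pay their weight in the root buffer and `4B`:
    -- two writes here and the spare `B` of each phase.
    have hw : weight H h * P.B + 4 * P.B ≤ (14 * H + 16) * P.B := by
      rw [← add_mul]
      refine Nat.mul_le_mul_right _ ?_
      simp only [weight]; omega
    have hW : (14 * H + 16) * tail.length + (14 * H + 16) = (14 * H + 16) * P.B := by
      rw [← htl]; ring
    have hstart : ∀ (T' : BufferTree K) (w : ℕ), T'.tail = [] →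
        Runs (if v.size + P.B < P.l * P.B then pure ⟨[], h, ⟨v'⟩⟩
          else do
            let r' ← emptyDown P h ⟨v'⟩
            let rs ← rebalance P h r'
            grow P rs.length h rs) T' (P.k * w) w 0 (P.M + 6 * P.B) →
        Runs (insert P x ⟨tail, h, ⟨v⟩⟩) T' (P.k * (2 + w)) (2 + w)
          ((T'.tail.length : ℤ) - tail.length) (P.M + 6 * P.B - tail.length) := by
      intro T' w e hr
      rw [hv'] at hr
      simp only [insert, if_neg hlt]
      refine Runs.mono (Runs.bind (runs_occupy 1) (Runs.bind (runs_storeList _)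
        (Runs.bind (runs_loadNode _) (Runs.bind (runs_storeNode _) hr)))) ?_ ?_ ?_ ?_
      all_goals try simp only [e, hys, List.length_nil, mul_add]
      all_goals omega
    by_cases hsz : v.size + P.B < P.l * P.B
    · simp only [if_pos hsz] at hstart
      refine ⟨⟨[], h, ⟨v'⟩⟩, 2 + 0, hstart _ 0 rfl ((Runs.pure _).mono (by omega) le_rfl rfl (by omega)),
        ⟨nodeOK_iff.2 ⟨hrecv, by rw [hv']; exact hsz⟩, hu', by rw [hv']; exact hfull', hB⟩, ?_,
        le_rfl, ?_⟩
      · exact hperm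
      · simp only [BufferTree.credit, hcredit, List.length_nil]
        omega
    · simp only [if_neg hsz] at hstart
      obtain ⟨r', w1, a1, a2, a3, a4, a5, a6⟩ := runs_emptyDown hP (wt := weight H)
        (fun h => by simp only [weight]; omega) h true ⟨v'⟩ hrecv hnd'
      obtain ⟨j, hj⟩ := Nat.exists_eq_add_of_le hH
      obtain ⟨rs, w2, b1, b2, b3, b4, b5⟩ := runs_rebalance hP (wt := weight H) (H := H)
        (by simp [weight]) h j hj.symm true r' a2 (a5.nodup_iff.2 hnd')
      rw [a3, hu'] at b2
      obtain ⟨T', w3, c1, c2, c3, c4, c5, c6, c7⟩ := runs_grow hP (weight H) (3 * (P.l * P.B))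
        rs.length h rs le_rfl b2 (by
          intro r hr b hb
          rcases b3 r hr with e | e
          · rw [e] at hb; simp at hb
          · rw [e] at hb
            rcases a4 with e | e
            · rw [e] at hb; simp at hb
            · rw [e] at hb
              refine hfull' b ?_
              rwa [hv'] at hb)
      refine ⟨T', 2 + (w1 + w2 + w3), hstart T' (w1 + w2 + w3) c3 ?_, c2, ?_, c4, ?_⟩
      · refine Runs.mono (Runs.bind a1 (Runs.bind b1 c1)) ?_ ?_ ?_ ?_
        · have := Nat.le_mul_of_pos_left w3 hk
          rw [mul_add, mul_add]
          omega
        all_goals omega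
      · rw [c3, c5, List.nil_append]
        exact b4.trans (a5.trans hperm)
      · dsimp only at a6
        rw [hcredit] at a6
        simp only [BufferTree.credit, c3, c6, List.length_nil]
        -- One share of `4B` per additional node at the root's level already pays for the new roots.
        have d1 : P.B * w3 ≤ 4 * P.B * (j + 1) * (rs.length - 1) := by
          calc P.B * w3 ≤ P.B * (4 * (rs.length - 1)) * 1 := by
                rw [mul_one]; exact Nat.mul_le_mul_left _ c7
            _ ≤ P.B * (4 * (rs.length - 1)) * (j + 1) := Nat.mul_le_mul_left _ (by omega)
            _ = _ := by ring
        have d2 : P.B * (2 + (w1 + w2 + w3)) = 2 * P.B + P.B * w1 + P.B * w2 + P.B * w3 := by ring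
        rw [d2]
        omega

theorem Runs.unique {α : Type u} {p : Prog α} {a b : α} {r w r' w' : ℕ} {d pk d' pk' : ℤ}
    (h : Runs p a r w d pk) (h' : Runs p b r' w' d' pk') : a = b :=
  (h Meter.zero).1.symm.trans (h' Meter.zero).1

/-- The weights depend on `H`, which must bound the final height, unknown until the run is over. So
the resulting tree is fixed first and the cost is stated for every admissible `H` afterwards. -/
theorem runs_insertAll {P : Params} (hP : P.Valid) (xs : List K) (T : BufferTree K)
    (hT : IsBufferTree P.l P.B T) (hnd : (T.records ++ xs).Nodup) :
    ∃ T' : BufferTree K, IsBufferTree P.l P.B T' ∧ T'.records.Perm (T.records ++ xs) ∧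
      T.height ≤ T'.height ∧ ∀ H, T'.height ≤ H → ∃ w : ℕ,
        Runs (insertAll P xs T) T' (P.k * w) w ((T'.tail.length : ℤ) - T.tail.length)
          (P.M + 6 * P.B - T.tail.length) ∧
        P.B * w + T'.credit P H ≤ T.credit P H + (14 * H + 16) * xs.length := by
  induction xs generalizing T with
  | nil =>
    have := hT.2.2.2
    refine ⟨T, hT, by simp, le_rfl, fun H _ => ⟨0, ?_, by simp⟩⟩
    exact (Runs.pure _).mono (by simp) le_rfl (by simp) (by omega)
  | cons x xs ih =>
    have e : T.records ++ x :: xs = T.records ++ [x] ++ xs := by simp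
    rw [e] at hnd ⊢
    have hnd1 := hnd.of_append_left
    obtain ⟨T₁, w₁, a1, a2, a3, a4, -⟩ := runs_insert hP x T hT hnd1 T.height le_rfl
    obtain ⟨T', b1, b2, b3, b4⟩ := ih T₁ a2 ((a3.append_right xs).nodup_iff.2 hnd)
    refine ⟨T', b1, b2.trans (a3.append_right xs), a4.trans b3, fun H hH => ?_⟩
    obtain ⟨w, c1, c2⟩ := b4 H hH
    -- The same insertion is accounted for again with the larger `H`; its result is the same tree by
    -- `Runs.unique`.
    obtain ⟨T₂, w₂, d1, -, -, -, d2⟩ := runs_insert hP x T hT hnd1 H (a4.trans (b3.trans hH))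
    obtain rfl := d1.unique a1
    refine ⟨w₂ + w, ?_, ?_⟩
    · refine Runs.mono (Runs.bind d1 c1) ?_ ?_ ?_ ?_
      all_goals try simp only [mul_add]
      all_goals omega
    · rw [List.length_cons, mul_add, mul_add, mul_one]
      omega

end Insertion

/-! ### Height of the tree and the final estimate -/

section Height

variable {K : Type u}

theorem length_mul_le_childRecords {h a b : ℕ} {cs : List (Stored (Tree K h))}
    (hc : ∀ c ∈ cs, a ≤ b * (recordsOf h c.contents).length) :
    cs.length * a ≤ b * (childRecords h cs).length := by
  induction cs with
  | nil => simp
  | cons c cs ih =>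
    have h1 := ih fun d hd => hc d (by simp [hd])
    have h2 := hc c (by simp)
    rw [childRecords_cons, List.length_append, List.length_cons, mul_add, Nat.succ_mul]
    omega

variable [LinearOrder K]

theorem NodeOK.pow_le {l B h : ℕ} {v : Tree K h} (hv : NodeOK l B h false v) :
    l ^ (h + 1) * B ≤ 4 ^ (h + 1) * (recordsOf h v).length := by
  induction h with
  | zero =>
    have h1 := hv.2.2.2.2.2.2.2.2 rfl
    rw [recordsOf_zero, List.length_append]
    simp only [zero_add, pow_one]
    omega
  | succ h ih =>
    obtain ⟨-, -, -, -, -, -, -, h4, hc, -⟩ := hv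
    have h1 := length_mul_le_childRecords fun c hc' => ih (hc c hc')
    have h2 := h4 rfl
    rw [recordsOf_succ, List.length_append]
    calc l ^ (h + 1 + 1) * B = l * (l ^ (h + 1) * B) := by ring
      _ ≤ 4 * List.length v.body * (l ^ (h + 1) * B) := Nat.mul_le_mul_right _ h2
      _ = 4 * (List.length v.body * (l ^ (h + 1) * B)) := by ring
      _ ≤ 4 * (4 ^ (h + 1) * (childRecords h v.body).length) := Nat.mul_le_mul_left _ h1
      _ = 4 ^ (h + 1 + 1) * (childRecords h v.body).length := by ring
      _ ≤ _ := Nat.mul_le_mul_left _ (Nat.le_add_left _ _)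

theorem NodeOK.root_pow_le {l B h n : ℕ} {v : Tree K h} (hB : 1 ≤ B) (hv : NodeOK l B h true v)
    (hn : 1 ≤ n) (hr : (recordsOf h v).length ≤ n) : l ^ h ≤ 4 ^ h * n := by
  cases h with
  | zero => simpa using hn
  | succ h =>
    obtain ⟨-, -, -, -, -, -, h2, -, hc, -⟩ := hv
    have h1 := length_mul_le_childRecords fun c hc' => (hc c hc').pow_le
    calc l ^ (h + 1) = 1 * (l ^ (h + 1) * 1) := by ring
      _ ≤ List.length v.body * (l ^ (h + 1) * B) :=
          Nat.mul_le_mul (by omega) (Nat.mul_le_mul_left _ hB)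
      _ ≤ 4 ^ (h + 1) * (childRecords h v.body).length := h1
      _ ≤ 4 ^ (h + 1) * n := Nat.mul_le_mul_left _ (by
          rw [recordsOf_succ, List.length_append] at hr; omega)

/-- For `l ≥ 8` one has `4 ^ 3 ≤ l ^ 2`, so `log 4` is at most two thirds of `log l`, and a third of
`h log l` is left. -/
theorem height_le_logb {l h n : ℕ} (hl : 8 ≤ l) (hn : 1 ≤ n) (hp : l ^ h ≤ 4 ^ h * n) :
    (h : ℝ) ≤ 3 * Real.logb l n := by
  have hl' : (8 : ℝ) ≤ l := by exact_mod_cast hl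
  have hn' : (1 : ℝ) ≤ n := by exact_mod_cast hn
  have h1 : 0 < Real.log l := Real.log_pos (by linarith)
  have h2 : 3 * Real.log 4 ≤ 2 * Real.log l := by
    have e1 : Real.log ((4 : ℝ) ^ 3) = 3 * Real.log 4 := by rw [Real.log_pow]; norm_num
    have e2 : Real.log ((l : ℝ) ^ 2) = 2 * Real.log l := by rw [Real.log_pow]; norm_num
    rw [← e1, ← e2]
    exact Real.log_le_log (by norm_num) (by nlinarith)
  have h3 : h * Real.log l ≤ h * Real.log 4 + Real.log n := by
    have hp' : (l : ℝ) ^ h ≤ 4 ^ h * n := by exact_mod_cast hp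
    have := Real.log_le_log (by positivity) hp'
    rwa [Real.log_mul (by positivity) (by positivity), Real.log_pow, Real.log_pow] at this
  rw [Real.logb, ← mul_div_assoc, le_div_iff₀ h1]
  nlinarith [(Nat.cast_nonneg h : (0 : ℝ) ≤ h)]

theorem isBufferTree_empty {P : Params} (hP : P.Valid) :
    IsBufferTree P.l P.B (BufferTree.empty K) := by
  have hlB : 0 < P.l * P.B := Nat.mul_pos (by have := hP.le_l; omega) hP.one_le_B
  refine ⟨⟨dense_nil _, rfl, hlB, ?_, dense_nil _, List.Pairwise.nil, Nat.zero_le _,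
    Nat.zero_le _, fun h => by cases h⟩, rfl, ?_, hP.one_le_B⟩
  · intro x hx; cases hx
  · intro x hx; cases hx

theorem cost_le {w B n l h k r : ℕ} (hB : 1 ≤ B) (hr : r ≤ k * w)
    (hw : B * w ≤ (14 * h + 16) * n) (hh : (h : ℝ) ≤ 3 * Real.logb l n) :
    (r : ℝ) ≤ 48 * (n * (((k : ℝ) / B) * (1 + Real.logb l n))) := by
  have hB' : (0 : ℝ) < B := by exact_mod_cast hB
  have hr' : (r : ℝ) ≤ k * w := by exact_mod_cast hr
  have hw' : (B : ℝ) * w ≤ (14 * h + 16) * n := by exact_mod_cast hw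
  have hn : (0 : ℝ) ≤ n := Nat.cast_nonneg n
  have hk : (0 : ℝ) ≤ k := Nat.cast_nonneg k
  -- From `14h + 16 ≤ 42 log_l n + 16`, where `log_l n ≥ 0` because `h ≥ 0`.
  have h1 : (B : ℝ) * w ≤ 48 * (1 + Real.logb l n) * n :=
    hw'.trans (mul_le_mul_of_nonneg_right (by linarith) hn)
  have h2 : (w : ℝ) ≤ 48 * (1 + Real.logb l n) * n / B := by
    rw [le_div_iff₀ hB']; linarith
  calc (r : ℝ) ≤ k * w := hr'
    _ ≤ k * (48 * (1 + Real.logb l n) * n / B) := mul_le_mul_of_nonneg_left h2 hk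
    _ = _ := by ring

end Height
end AEM

/-- Amortized cost of insertion: `n` insertions of distinct keys into the initially empty buffer
tree with branching factor `kM/B` cost `O(n (k/B) (1 + log_{kM/B} n))` reads and
`O(n (1/B) (1 + log_{kM/B} n))` writes, in primary memory of size `O(M)`. -/
theorem mainTheorem5 :
    ∃ C : ℝ, 0 < C ∧
      ∀ (K : Type u) [LinearOrder K] (k M B : ℕ), 1 ≤ k → 1 ≤ B → B ∣ M → 8 * B ≤ k * M →
        ∀ xs : List K, xs.Nodup →
          ∀ (T : AEM.BufferTree K) (m : AEM.Meter),
            AEM.insertAll ⟨k, M, B⟩ xs (AEM.BufferTree.empty K) AEM.Meter.zero = (T, m) →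
            AEM.IsBufferTree (k * M / B) B T ∧
            T.records.Perm xs ∧
            (m.reads : ℝ) ≤ C * (xs.length *
              (((k : ℝ) / B) * (1 + Real.logb ((k : ℝ) * M / B) xs.length))) ∧
            (m.writes : ℝ) ≤ C * (xs.length *
              ((1 / (B : ℝ)) * (1 + Real.logb ((k : ℝ) * M / B) xs.length))) ∧
            m.held = T.tail.length ∧
            (m.peak : ℝ) ≤ C * M := by
  refine ⟨48, by norm_num, ?_⟩
  intro K _ k M B hk hB hBM hkM xs hnd T m hrun
  have hP : AEM.Params.Valid ⟨k, M, B⟩ := ⟨hk, hB, hBM, (Nat.le_div_iff_mul_le hB).2 hkM⟩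
  have hrec : (AEM.BufferTree.empty K).records = [] := rfl
  obtain ⟨T', h1, h2, -, h3⟩ := AEM.runs_insertAll hP xs (AEM.BufferTree.empty K)
    (AEM.isBufferTree_empty hP) (by rw [hrec]; exact hnd)
  obtain ⟨w, h4, h5⟩ := h3 T'.height le_rfl
  obtain ⟨e, hr, hw, hheld, hpeak⟩ := h4 AEM.Meter.zero
  rw [hrun] at e hr hw hheld hpeak
  dsimp only at e hr hw hheld hpeak
  subst e
  rw [hrec, List.nil_append] at h2
  have hcredit : (AEM.BufferTree.empty K).credit ⟨k, M, B⟩ T.height = 0 := rfl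
  rw [hcredit, zero_add] at h5
  have hl : (k : ℝ) * M / B = ((k * M / B : ℕ) : ℝ) := by
    rw [Nat.cast_div (hBM.mul_left k) (by positivity)]
    push_cast
    rfl
  -- The height bound needs `n ≥ 1`; without insertions the cost is zero.
  have hlog : (T.height : ℝ) ≤ 3 * Real.logb ((k * M / B : ℕ) : ℝ) xs.length ∨ xs = [] := by
    by_cases hn : 1 ≤ xs.length
    · left
      refine AEM.height_le_logb hP.le_l hn (h1.1.root_pow_le hB hn ?_)
      rw [← h2.length_eq, AEM.BufferTree.records, List.length_append]
      omega
    · right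
      exact List.length_eq_zero_iff.1 (by omega)
  have hBw : B * w ≤ (14 * T.height + 16) * xs.length := by
    have : B * w + _ ≤ _ := h5
    omega
  have hr' : m.reads ≤ k * w := by simpa [AEM.Meter.zero] using hr
  -- The factor 1 lets `cost_le` serve for the writes as well, with 1 in place of `k`.
  have hw' : m.writes ≤ 1 * w := by simpa [AEM.Meter.zero] using hw
  refine ⟨h1, h2, ?_, ?_, ?_, ?_⟩
  · rw [hl]
    rcases hlog with hlog | rfl
    · exact AEM.cost_le hB hr' hBw hlog
    · have : w = 0 := by simp at hBw; omega
      rw [this] at hr'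
      have : m.reads = 0 := by omega
      simp [this]
  · rw [hl]
    rcases hlog with hlog | rfl
    · have := AEM.cost_le hB hw' hBw hlog
      simpa using this
    · have : w = 0 := by simp at hBw; omega
      rw [this] at hw'
      have : m.writes = 0 := by omega
      simp [this]
  · simpa [AEM.Meter.zero, AEM.BufferTree.empty] using hheld
  · have hBM' : (B : ℤ) ≤ M := by exact_mod_cast hP.B_le_M
    have h6 : m.peak ≤ 48 * M := by
      simp only [AEM.Meter.zero, AEM.BufferTree.empty, List.length_nil] at hpeak
      omega
    exact_mod_cast h6
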